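/- Let $E_1$ be the operator on $L^2(\mathbb{R}^2;\mathbb{C})$ given by the Fourier multiplier $\xi_1^2/|\xi|^2$, that is, $E_1 f=\mathcal{F}^{-1}\big(\tfrac{\xi_1^2}{|\xi|^2}\,\mathcal{F}f\big)$. Let $1<p<3$ and $\omega\in\mathbb{R}$. If there is a function $u\in H^1(\mathbb{R}^2;\mathbb{C})$, $u\neq 0$, that satisfies $$\Delta u-\omega u+|u|^{p-1}u+E_1(|u|^2)u=0$$ on $\mathbb{R}^2$ in the sense of distributions, then $\omega>0$. (Here $|u|^2\in L^2(\mathbb{R}^2)$ because $H^1(\mathbb{R}^2)\subset L^4(\mathbb{R}^2)$.) -/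

import Mathlib

open MeasureTheory FourierTransform
open scoped SchwartzMap ENNReal

noncomputable section

namespace DaveyStewartson

/-- The Euclidean plane. -/
abbrev Plane : Type := EuclideanSpace ℝ (Fin 2)

/-- Complex-valued square-integrable functions on the plane (Lebesgue measure). -/
abbrev L2 : Type := Lp ℂ 2 (volume : Measure Plane)

/-- The symbol `ξ₁² / |ξ|²`. Its value at the single point `ξ = 0` is irrelevant. -/
def symbol (ξ : Plane) : ℝ := ξ 0 ^ 2 / ‖ξ‖ ^ 2

theorem measurable_symbol : Measurable symbol := by
  unfold symbol
  fun_prop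

theorem symbol_nonneg (ξ : Plane) : 0 ≤ symbol ξ := by
  unfold symbol
  positivity

theorem symbol_le_one (ξ : Plane) : symbol ξ ≤ 1 := by
  refine div_le_one_of_le₀ ?_ (by positivity)
  rw [EuclideanSpace.real_norm_sq_eq, Fin.sum_univ_two]
  nlinarith [sq_nonneg (ξ 1)]

theorem memLp_symbol_mul (g : L2) :
    MemLp (fun ξ : Plane => (symbol ξ : ℂ) * g ξ) 2 volume := by
  refine (Lp.memLp g).of_le ?_ (Filter.Eventually.of_forall fun ξ => ?_)
  · exact (Complex.measurable_ofReal.comp measurable_symbol).aestronglyMeasurable.mul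
      (Lp.aestronglyMeasurable g)
  · rw [norm_mul, Complex.norm_real, Real.norm_of_nonneg (symbol_nonneg ξ)]
    exact mul_le_of_le_one_left (norm_nonneg _) (symbol_le_one ξ)

/-- The singular integral operator `E₁ f = 𝓕⁻¹ (ξ₁² / |ξ|² · 𝓕 f)` on `L²`. Here `𝓕` is the
Plancherel transform extending `∫ e^{-2πi x·ξ} f(x) dx`; since the symbol is homogeneous of
degree zero, the normalization `(2π)⁻¹ ∫ e^{-i x·ξ} f(x) dx` gives the same operator. -/
def E₁L2 (f : L2) : L2 := 𝓕⁻ ((memLp_symbol_mul (𝓕 f)).toLp _)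

open Classical in
/-- `E₁` applied to a square-integrable function. The second branch is a placeholder that is
never used for `f = |u|²` with `u ∈ H¹`, because `H¹` of the plane embeds in `L⁴`. -/
def E₁ (f : Plane → ℂ) : Plane → ℂ :=
  if hf : MemLp f 2 volume then E₁L2 (hf.toLp f) else 0

/-- `u ∈ H¹` is a solution, in the sense of distributions, of
`Δu - ω u + |u|^{p-1} u + E₁(|u|²) u = 0` on the plane. -/
structure IsSolution (p ω : ℝ) (u : L2) : Prop where
  memH1 : TemperedDistribution.MemSobolev 1 2 (u : 𝓢'(Plane, ℂ))
  equation : ∀ φ : Plane → ℂ, ContDiff ℝ ((⊤ : ℕ∞) : WithTop ℕ∞) φ → HasCompactSupport φ →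
    (∫ x, u x * Laplacian.laplacian φ x) - ω * (∫ x, u x * φ x)
      + (∫ x, ((‖u x‖ ^ (p - 1) : ℝ) : ℂ) * u x * φ x)
      + (∫ x, E₁ (fun y => ((‖u y‖ ^ 2 : ℝ) : ℂ)) x * u x * φ x) = 0

end DaveyStewartson

end

/-!
A solution satisfies the Pohozaev identity
`ω ‖u‖² = 2 / (p + 1) ∫ |u|^{p+1} + ½ ∫ σ |𝓕 (|u|²)|²`, where `σ` is the symbol of `E₁`, and its
right-hand side is positive when `u ≠ 0`. Formally the identity is the sum over the coordinates of
the equation tested with `x_j ∂_j u`. As `u` is only known to be in `H¹`, that test function is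
replaced by `sin (2π t x_j) (u (x + s e_j) - u (x - s e_j))`; dividing by `s` and by `t`, one lets
`s → 0` and then `t → 0`. Convexity of `z ↦ |z|^{p+1}` takes the place of a chain rule in the power
term. In the nonlocal term the symbol is differenced against a Lipschitz function, which gives a
bounded multiplier, and since `σ` is homogeneous of degree zero its derivatives cancel in the sum
over `j`.
-/


noncomputable section

namespace DaveyStewartson

open Real ComplexConjugate Filter Topology
open scoped InnerProductSpace LineDeriv

/-- Square-integrable complex functions on a Euclidean space. -/
local notation "L²(" E ")" => Lp ℂ 2 (volume : Measure E)

theorem memLp_mul_of_norm_le {α : Type*} {mα : MeasurableSpace α} {μ : Measure α} {m : α → ℂ}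
    {C : ℝ} (hm : AEStronglyMeasurable m μ) (hC : ∀ᵐ x ∂μ, ‖m x‖ ≤ C) (f : Lp ℂ 2 μ) :
    MemLp (fun x => m x * f x) 2 μ :=
  (Lp.memLp f).of_le_mul (hm.mul (Lp.aestronglyMeasurable f)) <| by
    filter_upwards [hC] with x hx
    rw [norm_mul]
    exact mul_le_mul_of_nonneg_right hx (norm_nonneg _)

section Fourier

variable {E : Type*} [NormedAddCommGroup E] [InnerProductSpace ℝ E]

/-- The plane wave `e^{2πi τ·x}`. -/
def wave (τ x : E) : ℂ := 𝐞 ⟪τ, x⟫_ℝ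

theorem continuous_wave (τ : E) : Continuous (wave τ) := by
  unfold wave
  fun_prop

@[simp]
theorem norm_wave (τ x : E) : ‖wave τ x‖ = 1 := Circle.norm_coe _

theorem wave_eq_cos_add_sin (τ x : E) :
    wave τ x = (cos (2 * π * ⟪τ, x⟫_ℝ) : ℂ) + (sin (2 * π * ⟪τ, x⟫_ℝ) : ℂ) * Complex.I := by
  rw [wave, Real.fourierChar_apply, Complex.exp_mul_I, Complex.ofReal_cos, Complex.ofReal_sin]

theorem conj_wave (τ x : E) : conj (wave τ x) = wave (-τ) x := by
  rw [wave, wave, inner_neg_left, AddChar.map_neg_eq_inv, Circle.coe_inv_eq_conj]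

variable [FiniteDimensional ℝ E] [MeasurableSpace E] [BorelSpace E]

theorem schwartz_induction {P : L²(E) → Prop} (hP : IsClosed {f | P f})
    (h : ∀ φ : 𝓢(E, ℂ), P (φ.toLp 2)) (f : L²(E)) : P f :=
  (SchwartzMap.denseRange_toLpCLM (F := ℂ) (μ := (volume : Measure E))
    (p := 2) ENNReal.ofNat_ne_top).induction_on f hP h

/-! ### Translations and modulations -/

/-- The translation `f ↦ f (· + h)` of `L²`. -/
def translate (h : E) : L²(E) →ₗᵢ[ℂ] L²(E) :=
  Lp.compMeasurePreservingₗᵢ ℂ (fun x : E => x + h) (measurePreserving_add_right volume h)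

theorem coeFn_translate (h : E) (f : L²(E)) : translate h f =ᵐ[volume] fun x => f (x + h) :=
  Lp.coeFn_compMeasurePreserving f (measurePreserving_add_right volume h)

theorem translate_zero (f : L²(E)) : translate 0 f = f := by
  refine Lp.ext ?_
  filter_upwards [coeFn_translate 0 f] with x hx
  rw [hx, add_zero]

theorem translate_toLp (h : E) (φ : 𝓢(E, ℂ)) :
    translate h (φ.toLp 2) = (φ.compSubConstCLM ℂ (-h)).toLp 2 := by
  refine Lp.ext ?_
  filter_upwards [coeFn_translate h (φ.toLp 2), (φ.compSubConstCLM ℂ (-h)).coeFn_toLp 2,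
    (measurePreserving_add_right volume h).quasiMeasurePreserving.ae
      (φ.coeFn_toLp 2 volume)]
    with x h₁ h₂ h₃
  rw [h₁, h₂, h₃, SchwartzMap.compSubConstCLM_apply, sub_neg_eq_add]

theorem memLp_wave_mul (τ : E) (f : L²(E)) : MemLp (fun x => wave τ x * f x) 2 volume :=
  memLp_mul_of_norm_le (continuous_wave τ).aestronglyMeasurable
    (C := 1) (by simp) f

/-- The modulation `f ↦ e^{2πi τ·x} f` of `L²`. -/
def modulate (τ : E) : L²(E) →ₗᵢ[ℂ] L²(E) where
  toFun f := (memLp_wave_mul τ f).toLp _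
  map_add' f g := Lp.ext <| by
    filter_upwards [(memLp_wave_mul τ (f + g)).coeFn_toLp, Lp.coeFn_add f g,
      Lp.coeFn_add ((memLp_wave_mul τ f).toLp _) ((memLp_wave_mul τ g).toLp _),
      (memLp_wave_mul τ f).coeFn_toLp, (memLp_wave_mul τ g).coeFn_toLp] with x h₁ h₂ h₃ h₄ h₅
    rw [h₁, h₃, Pi.add_apply, h₄, h₅, h₂, Pi.add_apply, mul_add]
  map_smul' c f := Lp.ext <| by
    filter_upwards [(memLp_wave_mul τ (c • f)).coeFn_toLp, Lp.coeFn_smul c f,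
      Lp.coeFn_smul c ((memLp_wave_mul τ f).toLp _), (memLp_wave_mul τ f).coeFn_toLp]
      with x h₁ h₂ h₃ h₄
    rw [h₁, RingHom.id_apply, h₃, Pi.smul_apply, h₄, h₂, Pi.smul_apply, smul_eq_mul, smul_eq_mul,
      mul_left_comm]
  norm_map' f := by
    change ‖(memLp_wave_mul τ f).toLp _‖ = ‖f‖
    rw [Lp.norm_toLp, Lp.norm_def]
    exact congrArg _ (eLpNorm_congr_norm_ae (Eventually.of_forall fun x => by simp))

theorem coeFn_modulate (τ : E) (f : L²(E)) :
    modulate τ f =ᵐ[volume] fun x => wave τ x * f x :=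
  (memLp_wave_mul τ f).coeFn_toLp

theorem fourier_compSubConst (φ : 𝓢(E, ℂ)) (h x : E) :
    (𝓕 (φ.compSubConstCLM ℂ h)) x = wave (-h) x * (𝓕 φ) x := by
  have hφ : (φ.compSubConstCLM ℂ h : E → ℂ) = φ ∘ fun y => y + -h :=
    funext fun y => by rw [SchwartzMap.compSubConstCLM_apply, sub_eq_add_neg, Function.comp_apply]
  rw [SchwartzMap.fourier_coe, SchwartzMap.fourier_coe, hφ]
  exact congr_fun (VectorFourier.fourierIntegral_comp_add_right 𝐞 volume (innerₗ E) φ (-h)) x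

theorem fourierInv_compSubConst (φ : 𝓢(E, ℂ)) (h x : E) :
    (𝓕⁻ (φ.compSubConstCLM ℂ h)) x = wave h x * (𝓕⁻ φ) x := by
  have key := fourier_compSubConst φ h (-x)
  rw [wave, inner_neg_neg, ← wave, SchwartzMap.fourier_coe, SchwartzMap.fourier_coe] at key
  simpa only [SchwartzMap.fourierInv_coe, Real.fourierInv_eq_fourier_neg] using key

theorem fourier_translate (h : E) (f : L²(E)) : 𝓕 (translate h f) = modulate h (𝓕 f) := by
  induction f using schwartz_induction with
  | hP =>
    exact isClosed_eq (continuous_fourier.comp (translate h).continuous)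
      ((modulate h).continuous.comp continuous_fourier)
  | h φ =>
    rw [translate_toLp, SchwartzMap.toLp_fourier_eq, SchwartzMap.toLp_fourier_eq]
    refine Lp.ext ?_
    filter_upwards [(𝓕 (φ.compSubConstCLM ℂ (-h))).coeFn_toLp 2, (𝓕 φ).coeFn_toLp 2,
      coeFn_modulate h ((𝓕 φ).toLp 2)] with ξ h₁ h₂ h₃
    rw [h₁, h₃, h₂, fourier_compSubConst, neg_neg]

theorem fourierInv_translate (h : E) (f : L²(E)) :
    𝓕⁻ (translate h f) = modulate (-h) (𝓕⁻ f) := by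
  induction f using schwartz_induction with
  | hP =>
    exact isClosed_eq (continuous_fourierInv.comp (translate h).continuous)
      ((modulate (-h)).continuous.comp continuous_fourierInv)
  | h φ =>
    rw [translate_toLp, SchwartzMap.toLp_fourierInv_eq, SchwartzMap.toLp_fourierInv_eq]
    refine Lp.ext ?_
    filter_upwards [(𝓕⁻ (φ.compSubConstCLM ℂ (-h))).coeFn_toLp 2, (𝓕⁻ φ).coeFn_toLp 2,
      coeFn_modulate (-h) ((𝓕⁻ φ).toLp 2)] with ξ h₁ h₂ h₃
    rw [h₁, h₃, h₂, fourierInv_compSubConst]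

theorem fourier_modulate (τ : E) (f : L²(E)) :
    𝓕 (modulate τ f) = translate (-τ) (𝓕 f) := by
  have h := fourierInv_translate (-τ) (𝓕 f)
  rw [neg_neg, fourierInv_fourier_eq] at h
  rw [← h, fourier_fourierInv_eq]

theorem inner_modulate_left (τ : E) (f g : L²(E)) :
    ⟪modulate τ f, g⟫_ℂ = ⟪f, modulate (-τ) g⟫_ℂ := by
  rw [L2.inner_def, L2.inner_def]
  refine integral_congr_ae ?_
  filter_upwards [coeFn_modulate τ f, coeFn_modulate (-τ) g] with x h₁ h₂
  rw [h₁, h₂, RCLike.inner_apply, RCLike.inner_apply, map_mul, conj_wave]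
  ring

theorem inner_translate_left (h : E) (f g : L²(E)) :
    ⟪translate h f, g⟫_ℂ = ⟪f, translate (-h) g⟫_ℂ := by
  rw [← Lp.inner_fourier_eq, ← Lp.inner_fourier_eq f, fourier_translate, fourier_translate,
    inner_modulate_left]

theorem translate_modulate (h τ : E) (f : L²(E)) :
    translate h (modulate τ f) = wave τ h • modulate τ (translate h f) := by
  refine Lp.ext ?_
  filter_upwards [coeFn_translate h (modulate τ f), coeFn_modulate τ (translate h f),
    Lp.coeFn_smul (wave τ h) (modulate τ (translate h f)), coeFn_translate h f,
    (measurePreserving_add_right volume h).quasiMeasurePreserving.ae (coeFn_modulate τ f)]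
    with x h₁ h₂ h₃ h₄ h₅
  have hw : wave τ (x + h) = wave τ h * wave τ x := by
    rw [wave, inner_add_right, AddChar.map_add_eq_mul, Circle.coe_mul, mul_comm, wave, wave]
  rw [h₁, h₅, h₃, Pi.smul_apply, h₂, h₄, hw, smul_eq_mul, mul_assoc]

end Fourier

/-! ### Convergence of bounded multipliers -/

section Multiplier

variable {α ι : Type*} {mα : MeasurableSpace α} {μ : Measure α} {l : Filter ι}
  [l.IsCountablyGenerated] {m : ι → α → ℂ} {m₀ : α → ℂ} {C : ℝ}

theorem tendsto_of_tendsto_multiplier {f : Lp ℂ 2 μ} {F : ι → Lp ℂ 2 μ} {F₀ : Lp ℂ 2 μ}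
    (hF : ∀ i, F i =ᵐ[μ] fun x => m i x * f x) (hF₀ : F₀ =ᵐ[μ] fun x => m₀ x * f x)
    (hC : ∀ i x, ‖m i x‖ ≤ C) (hC₀ : ∀ᵐ x ∂μ, ‖m₀ x‖ ≤ C)
    (hlim : ∀ᵐ x ∂μ, Tendsto (fun i => m i x) l (𝓝 (m₀ x))) : Tendsto F l (𝓝 F₀) := by
  have hsub (i : ι) : F i - F₀ =ᵐ[μ] fun x => (m i x - m₀ x) * f x := by
    filter_upwards [Lp.coeFn_sub (F i) F₀, hF i, hF₀] with x h₁ h₂ h₃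
    rw [h₁, Pi.sub_apply, h₂, h₃, sub_mul]
  have hnorm (i : ι) : ‖F i - F₀‖ ^ 2 = ∫ x, ‖(m i x - m₀ x) * f x‖ ^ 2 ∂μ := by
    rw [← inner_self_eq_norm_sq (𝕜 := ℂ), L2.inner_def, ← integral_re (L2.integrable_inner _ _)]
    refine integral_congr_ae ?_
    filter_upwards [hsub i] with x hx
    rw [hx, inner_self_eq_norm_sq]
  have hsq : Tendsto (fun i => ‖F i - F₀‖ ^ 2) l (𝓝 (∫ _, 0 ∂μ)) := by
    simp only [hnorm]
    refine tendsto_integral_filter_of_dominated_convergence (fun x => (2 * C) ^ 2 * ‖f x‖ ^ 2)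
      (Eventually.of_forall fun i => ?_) (Eventually.of_forall fun i => ?_)
      ((Lp.memLp f).integrable_norm_pow two_ne_zero |>.const_mul _) ?_
    · exact ((Lp.aestronglyMeasurable (F i - F₀)).congr (hsub i)).norm.pow 2
    · filter_upwards [hC₀] with x hx
      rw [norm_pow, norm_norm, norm_mul, mul_pow, two_mul]
      gcongr
      exact (norm_sub_le _ _).trans (add_le_add (hC i x) hx)
    · filter_upwards [hlim] with x hx
      simpa using (((hx.sub_const (m₀ x)).mul_const (f x)).norm.pow 2)
  rw [integral_zero] at hsq
  rw [tendsto_iff_norm_sub_tendsto_zero]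
  simpa using hsq.sqrt

theorem tendsto_integral_multiplier [l.NeBot] {G : ι → Lp ℂ 2 μ} {G₀ : Lp ℂ 2 μ} (g : Lp ℂ 2 μ)
    (hm : ∀ i, AEStronglyMeasurable (m i) μ) (hC : ∀ i x, ‖m i x‖ ≤ C)
    (hlim : ∀ᵐ x ∂μ, Tendsto (fun i => m i x) l (𝓝 (m₀ x))) (hG : Tendsto G l (𝓝 G₀)) :
    Tendsto (fun i => ∫ x, m i x * (g x * conj (G i x)) ∂μ) l
      (𝓝 (∫ x, m₀ x * (g x * conj (G₀ x)) ∂μ)) := by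
  have hC₀ : ∀ᵐ x ∂μ, ‖m₀ x‖ ≤ C := by
    filter_upwards [hlim] with x hx
    exact le_of_tendsto hx.norm (Eventually.of_forall fun i => hC i x)
  have hmem (i : ι) := memLp_mul_of_norm_le (hm i) (Eventually.of_forall (hC i)) g
  have hmem₀ := memLp_mul_of_norm_le (aestronglyMeasurable_of_tendsto_ae l hm hlim) hC₀ g
  have hinner {M : α → ℂ} (hM : MemLp (fun x => M x * g x) 2 μ) (G : Lp ℂ 2 μ) :
      ∫ x, M x * (g x * conj (G x)) ∂μ = ⟪G, hM.toLp _⟫_ℂ := by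
    rw [L2.inner_def]
    refine integral_congr_ae ?_
    filter_upwards [hM.coeFn_toLp] with x hx
    rw [hx, RCLike.inner_apply, mul_assoc]
  simp only [fun i => hinner (hmem i), hinner hmem₀]
  exact hG.inner (tendsto_of_tendsto_multiplier (fun i => (hmem i).coeFn_toLp) hmem₀.coeFn_toLp hC
    hC₀ hlim)

end Multiplier

theorem tendsto_smul_nhds_zero {E : Type*} [AddCommGroup E] [Module ℝ E]
    [TopologicalSpace E] [ContinuousSMul ℝ E] (m : E) :
    Tendsto (fun s : ℝ => s • m) (𝓝 0) (𝓝 0) := by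
  have h : Continuous fun s : ℝ => s • m := continuous_id.smul continuous_const
  simpa using h.tendsto 0

section Trigonometric

variable {E : Type*} [NormedAddCommGroup E] [InnerProductSpace ℝ E] [FiniteDimensional ℝ E]
  [MeasurableSpace E] [BorelSpace E]

theorem tendsto_modulate (f : L²(E)) : Tendsto (fun τ => modulate τ f) (𝓝 0) (𝓝 f) := by
  refine tendsto_of_tendsto_multiplier (m₀ := fun _ => 1) (fun τ => coeFn_modulate τ f)
    (by simp) (fun τ x => (norm_wave τ x).le) (by simp) (Eventually.of_forall fun x => ?_)
  have h : Continuous fun τ : E => wave τ x := by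
    unfold wave
    fun_prop
  simpa [wave] using h.tendsto 0

theorem tendsto_of_tendsto_fourier {ι : Type*} {l : Filter ι} {F : ι → L²(E)} {F₀ : L²(E)}
    (hF : Tendsto (fun i => 𝓕 (F i)) l (𝓝 (𝓕 F₀))) : Tendsto F l (𝓝 F₀) := by
  simpa only [Function.comp_def, fourierInv_fourier_eq] using
    (continuous_fourierInv.tendsto _).comp hF

theorem tendsto_translate (f : L²(E)) : Tendsto (fun h => translate h f) (𝓝 0) (𝓝 f) :=
  tendsto_of_tendsto_fourier (by simpa only [fourier_translate] using tendsto_modulate (𝓕 f))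

/-- Multiplication by `sin (2π τ·x)`. -/
def sinMul (τ : E) : L²(E) →L[ℂ] L²(E) :=
  (2 * Complex.I)⁻¹ • ((modulate τ).toContinuousLinearMap -
    (modulate (-τ)).toContinuousLinearMap)

/-- Multiplication by `cos (2π τ·x)`. -/
def cosMul (τ : E) : L²(E) →L[ℂ] L²(E) :=
  (2 : ℂ)⁻¹ • ((modulate τ).toContinuousLinearMap + (modulate (-τ)).toContinuousLinearMap)

theorem sinMul_apply (τ : E) (f : L²(E)) :
    sinMul τ f = (2 * Complex.I)⁻¹ • (modulate τ f - modulate (-τ) f) := rfl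

theorem cosMul_apply (τ : E) (f : L²(E)) :
    cosMul τ f = (2 : ℂ)⁻¹ • (modulate τ f + modulate (-τ) f) := rfl

theorem coeFn_sinMul (τ : E) (f : L²(E)) :
    sinMul τ f =ᵐ[volume] fun x => (sin (2 * π * ⟪τ, x⟫_ℝ) : ℂ) * f x := by
  rw [sinMul_apply]
  filter_upwards [Lp.coeFn_smul (2 * Complex.I)⁻¹ (modulate τ f - modulate (-τ) f),
    Lp.coeFn_sub (modulate τ f) (modulate (-τ) f), coeFn_modulate τ f, coeFn_modulate (-τ) f]
    with x h₁ h₂ h₃ h₄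
  rw [h₁, Pi.smul_apply, h₂, Pi.sub_apply, h₃, h₄, wave_eq_cos_add_sin, wave_eq_cos_add_sin,
    inner_neg_left, mul_neg, cos_neg, sin_neg, smul_eq_mul]
  have := Complex.I_ne_zero
  push_cast
  field_simp
  ring

theorem inner_sinMul_left (τ : E) (f g : L²(E)) : ⟪sinMul τ f, g⟫_ℂ = ⟪f, sinMul τ g⟫_ℂ := by
  have hI : conj (2 * Complex.I)⁻¹ = -(2 * Complex.I)⁻¹ := by
    simp [Complex.conj_ofNat]
  rw [sinMul_apply, sinMul_apply, inner_smul_left, inner_smul_right, inner_sub_left,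
    inner_sub_right, inner_modulate_left, inner_modulate_left, neg_neg, hI]
  ring

theorem translate_sinMul (h τ : E) (f : L²(E)) :
    translate h (sinMul τ f) = (cos (2 * π * ⟪τ, h⟫_ℝ) : ℂ) • sinMul τ (translate h f) +
      (sin (2 * π * ⟪τ, h⟫_ℝ) : ℂ) • cosMul τ (translate h f) := by
  rw [sinMul_apply, map_smul, map_sub, translate_modulate, translate_modulate, sinMul_apply,
    cosMul_apply, wave_eq_cos_add_sin, wave_eq_cos_add_sin, inner_neg_left, mul_neg, cos_neg,
    sin_neg, mul_inv, Complex.inv_I]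
  push_cast
  match_scalars <;> ring_nf <;> rw [Complex.I_sq] <;> ring

theorem tendsto_cosMul (f : L²(E)) : Tendsto (fun τ => cosMul τ f) (𝓝 0) (𝓝 f) := by
  have h := ((tendsto_modulate f).add ((tendsto_modulate f).comp
    (by simpa using (continuous_neg (G := E)).tendsto 0))).const_smul (2 : ℂ)⁻¹
  rw [← two_smul ℂ f, smul_smul, inv_mul_cancel₀ two_ne_zero, one_smul] at h
  exact h

end Trigonometric

/-! ### Weak derivatives -/

section ExpQuotient

/-- The quotient `(e^{iy} - 1) / (iy)`, continuously extended by `1` at `y = 0`: the multiplier of a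
difference quotient. -/
def expQuotient (y : ℝ) : ℂ := dslope (fun y : ℝ => Complex.exp (Complex.I * y)) 0 y / Complex.I

theorem hasDerivAt_exp_I_mul_zero :
    HasDerivAt (fun y : ℝ => Complex.exp (Complex.I * y)) Complex.I 0 := by
  simpa using ((hasDerivAt_id (0 : ℝ)).ofReal_comp.const_mul Complex.I).cexp

theorem continuous_expQuotient : Continuous expQuotient := by
  refine Continuous.div_const (continuousOn_univ.1 ?_) _
  exact (continuousOn_dslope univ_mem).2
    ⟨by fun_prop, hasDerivAt_exp_I_mul_zero.differentiableAt⟩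

theorem expQuotient_zero : expQuotient 0 = 1 := by
  rw [expQuotient, dslope_same, hasDerivAt_exp_I_mul_zero.deriv, div_self Complex.I_ne_zero]

theorem one_add_mul_expQuotient (y : ℝ) :
    1 + y * Complex.I * expQuotient y = Complex.exp (Complex.I * y) := by
  have h := sub_smul_dslope (fun y : ℝ => Complex.exp (Complex.I * y)) 0 y
  rw [sub_zero, Complex.ofReal_zero, mul_zero, Complex.exp_zero, Complex.real_smul] at h
  rw [expQuotient, mul_assoc, mul_div_cancel₀ _ Complex.I_ne_zero, h, add_sub_cancel]

theorem norm_expQuotient_le (y : ℝ) : ‖expQuotient y‖ ≤ 1 := by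
  rcases eq_or_ne y 0 with rfl | hy
  · rw [expQuotient_zero, norm_one]
  · refine le_of_mul_le_mul_left ?_ (norm_pos_iff.2 hy)
    have h : (y : ℂ) * Complex.I * expQuotient y = Complex.exp (Complex.I * y) - 1 :=
      eq_sub_of_add_eq' (one_add_mul_expQuotient y)
    calc ‖y‖ * ‖expQuotient y‖ = ‖Complex.exp (Complex.I * y) - 1‖ := by
          rw [← h, norm_mul, norm_mul, Complex.norm_I, mul_one, Complex.norm_real]
      _ ≤ ‖y‖ * 1 := by rw [mul_one]; exact norm_exp_I_mul_ofReal_sub_one_le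

end ExpQuotient

section WeakDerivative

variable {E : Type*} [NormedAddCommGroup E] [InnerProductSpace ℝ E] [FiniteDimensional ℝ E]
  [MeasurableSpace E] [BorelSpace E]

theorem fourier_sub (f g : L²(E)) : 𝓕 (f - g) = 𝓕 f - 𝓕 g :=
  map_sub (Lp.fourierTransformₗᵢ E ℂ) f g

/-- `u` has the weak derivative `v` in the direction `m`; both are square integrable, and the
relation is stated on the Fourier side. -/
def HasWeakDeriv (m : E) (u v : L²(E)) : Prop :=
  (𝓕 v : L²(E)) =ᵐ[volume] fun ξ => (2 * π * ⟪ξ, m⟫_ℝ * Complex.I) * (𝓕 u : L²(E)) ξ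

namespace HasWeakDeriv

variable {m : E} {u v u' v' : L²(E)}

theorem sub (hu : HasWeakDeriv m u v) (hu' : HasWeakDeriv m u' v') :
    HasWeakDeriv m (u - u') (v - v') := by
  unfold HasWeakDeriv at *
  rw [fourier_sub, fourier_sub]
  filter_upwards [hu, hu', Lp.coeFn_sub (𝓕 u) (𝓕 u'), Lp.coeFn_sub (𝓕 v) (𝓕 v')]
    with ξ h₁ h₂ h₃ h₄
  rw [h₃, h₄, Pi.sub_apply, Pi.sub_apply, h₁, h₂, mul_sub]

theorem const_smul (c : ℂ) (hu : HasWeakDeriv m u v) : HasWeakDeriv m (c • u) (c • v) := by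
  unfold HasWeakDeriv at *
  rw [fourier_smul, fourier_smul]
  filter_upwards [hu, Lp.coeFn_smul c (𝓕 u), Lp.coeFn_smul c (𝓕 v)] with ξ h₁ h₂ h₃
  rw [h₂, h₃, Pi.smul_apply, Pi.smul_apply, h₁, smul_eq_mul, smul_eq_mul, mul_left_comm]

theorem translate (h : E) (hu : HasWeakDeriv m u v) :
    HasWeakDeriv m (translate h u) (translate h v) := by
  unfold HasWeakDeriv at *
  rw [fourier_translate, fourier_translate]
  filter_upwards [hu, coeFn_modulate h (𝓕 u), coeFn_modulate h (𝓕 v)] with ξ h₁ h₂ h₃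
  rw [h₂, h₃, h₁, mul_left_comm]

theorem modulate (τ : E) (hu : HasWeakDeriv m u v) :
    HasWeakDeriv m (modulate τ u)
      (modulate τ v + (2 * π * ⟪τ, m⟫_ℝ * Complex.I : ℂ) • modulate τ u) := by
  unfold HasWeakDeriv at *
  rw [FourierTransform.fourier_add, fourier_smul, fourier_modulate, fourier_modulate]
  filter_upwards [(measurePreserving_add_right volume (-τ)).quasiMeasurePreserving.ae hu,
    coeFn_translate (-τ) (𝓕 u), coeFn_translate (-τ) (𝓕 v),
    Lp.coeFn_add (DaveyStewartson.translate (-τ) (𝓕 v))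
      ((2 * π * ⟪τ, m⟫_ℝ * Complex.I : ℂ) • DaveyStewartson.translate (-τ) (𝓕 u)),
    Lp.coeFn_smul (2 * π * ⟪τ, m⟫_ℝ * Complex.I : ℂ)
      (DaveyStewartson.translate (-τ) (𝓕 u))] with ξ h₁ h₂ h₃ h₄ h₅
  rw [h₄, Pi.add_apply, h₅, Pi.smul_apply, h₂, h₃, h₁, inner_add_left, inner_neg_left, smul_eq_mul]
  push_cast
  ring

theorem sinMul (τ : E) (hu : HasWeakDeriv m u v) :
    HasWeakDeriv m (sinMul τ u) (sinMul τ v + (2 * π * ⟪τ, m⟫_ℝ : ℂ) • cosMul τ u) := by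
  have hv : DaveyStewartson.sinMul τ v + (2 * π * ⟪τ, m⟫_ℝ : ℂ) • cosMul τ u =
      (2 * Complex.I)⁻¹ •
        (DaveyStewartson.modulate τ v +
            (2 * π * ⟪τ, m⟫_ℝ * Complex.I : ℂ) • DaveyStewartson.modulate τ u -
          (DaveyStewartson.modulate (-τ) v +
            (2 * π * ⟪-τ, m⟫_ℝ * Complex.I : ℂ) • DaveyStewartson.modulate (-τ) u)) := by
    rw [sinMul_apply, cosMul_apply, inner_neg_left, mul_inv, Complex.inv_I]
    push_cast
    match_scalars <;> ring_nf <;> rw [Complex.I_sq] <;> ring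
  rw [hv]
  exact ((hu.modulate τ).sub (hu.modulate (-τ))).const_smul _

theorem inner_left (hu : HasWeakDeriv m u v) (hu' : HasWeakDeriv m u' v') :
    ⟪v, u'⟫_ℂ = -⟪u, v'⟫_ℂ := by
  unfold HasWeakDeriv at *
  rw [← Lp.inner_fourier_eq, ← Lp.inner_fourier_eq u, L2.inner_def, L2.inner_def,
    ← integral_neg]
  refine integral_congr_ae ?_
  filter_upwards [hu, hu'] with ξ h₁ h₂
  rw [h₁, h₂, RCLike.inner_apply, RCLike.inner_apply]
  simp only [map_mul, Complex.conj_ofReal, Complex.conj_I, map_ofNat]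
  ring

end HasWeakDeriv

theorem hasWeakDeriv_toLp (m : E) (φ : 𝓢(E, ℂ)) :
    HasWeakDeriv m (φ.toLp 2) ((∂_{m} φ).toLp 2) := by
  have hm : (fun ξ : E => ⟪ξ, m⟫_ℝ).HasTemperateGrowth := by fun_prop
  unfold HasWeakDeriv
  rw [SchwartzMap.toLp_fourier_eq, SchwartzMap.toLp_fourier_eq, SchwartzMap.fourier_lineDerivOp_eq]
  filter_upwards [(𝓕 φ).coeFn_toLp 2, SchwartzMap.coeFn_toLp
    ((2 * π * Complex.I) • SchwartzMap.smulLeftCLM ℂ (fun ξ : E => ⟪ξ, m⟫_ℝ) (𝓕 φ)) 2]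
    with ξ h₁ h₂
  rw [h₁, h₂, smul_apply, SchwartzMap.smulLeftCLM_apply_apply hm, smul_eq_mul,
    Complex.real_smul]
  ring

theorem HasWeakDeriv.hasDerivAt_translate {m : E} {u v : L²(E)} (hu : HasWeakDeriv m u v) :
    HasDerivAt (fun s : ℝ => DaveyStewartson.translate (s • m) u) v 0 := by
  let k (s : ℝ) (ξ : E) : ℂ := expQuotient (2 * π * ⟪s • m, ξ⟫_ℝ)
  have hk (s : ℝ) (ξ : E) : ‖k s ξ‖ ≤ 1 := norm_expQuotient_le _
  have hmeas (s : ℝ) : AEStronglyMeasurable (k s) (volume : Measure E) :=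
    (continuous_expQuotient.comp (by fun_prop)).aestronglyMeasurable
  have hlim (ξ : E) : Tendsto (fun s => k s ξ) (𝓝 0) (𝓝 1) := by
    have h : Continuous fun s => k s ξ := continuous_expQuotient.comp (by fun_prop)
    simpa [k, expQuotient_zero] using h.tendsto 0
  have hmem (s : ℝ) := memLp_mul_of_norm_le (hmeas s) (Eventually.of_forall (hk s)) (𝓕 v)
  have hquot (s : ℝ) : 𝓕 (DaveyStewartson.translate (s • m) u - u) = (s : ℂ) • (hmem s).toLp _ := by
    rw [fourier_sub, fourier_translate]
    refine Lp.ext ?_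
    filter_upwards [hu, coeFn_modulate (s • m) (𝓕 u), (hmem s).coeFn_toLp,
      Lp.coeFn_sub (DaveyStewartson.modulate (s • m) (𝓕 u)) (𝓕 u),
      Lp.coeFn_smul (s : ℂ) ((hmem s).toLp _)] with ξ h₁ h₂ h₃ h₄ h₅
    rw [h₄, Pi.sub_apply, h₂, h₅, Pi.smul_apply, h₃, h₁, wave, Real.fourierChar_apply,
      mul_comm _ Complex.I, ← one_add_mul_expQuotient, real_inner_smul_left, real_inner_comm,
      smul_eq_mul]
    simp only [k, real_inner_smul_left, real_inner_comm ξ m]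
    push_cast
    ring
  have hM : Tendsto (fun s => 𝓕⁻ ((hmem s).toLp _)) (𝓝 0) (𝓝 v) := by
    have h := continuous_fourierInv.tendsto _ |>.comp <|
      tendsto_of_tendsto_multiplier (f := 𝓕 v) (F₀ := 𝓕 v) (m₀ := fun _ => 1)
        (fun s => (hmem s).coeFn_toLp) (by simp) hk (by simp) (Eventually.of_forall hlim)
    rwa [fourierInv_fourier_eq] at h
  rw [hasDerivAt_iff_tendsto_slope_zero]
  refine (hM.mono_left nhdsWithin_le_nhds).congr' ?_
  filter_upwards [self_mem_nhdsWithin] with s hs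
  have h := congrArg (𝓕⁻ · : L²(E) → L²(E)) (hquot s)
  simp only [fourierInv_fourier_eq, fourierInv_smul] at h
  rw [zero_add, zero_smul, translate_zero, h, Complex.coe_smul]
  exact (inv_smul_smul₀ hs _).symm

open scoped ContDiff in
theorem exists_hasWeakDeriv {u : L²(E)}
    (hu : TemperedDistribution.MemSobolev 1 2 (u : 𝓢'(E, ℂ))) (m : E) :
    ∃ v : L²(E), HasWeakDeriv m u v := by
  obtain ⟨v, hv⟩ := TemperedDistribution.memSobolev_zero_iff.1
    (by simpa using hu.lineDerivOp (m := m))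
  have hm : (fun ξ : E => (⟪ξ, m⟫_ℝ : ℂ)).HasTemperateGrowth := by fun_prop
  have hloc (f : L²(E)) : LocallyIntegrable f volume :=
    (Lp.memLp f).locallyIntegrable one_le_two
  refine ⟨v, ae_eq_of_integral_contDiff_smul_eq (hloc _)
    ((hloc (𝓕 u)).continuous_mul (by fun_prop))
    fun g hg hgc => ?_⟩
  have hgC : ContDiff ℝ ∞ fun ξ => (g ξ : ℂ) := Complex.ofRealCLM.contDiff.comp hg
  let φ : 𝓢(E, ℂ) := (hgc.comp_left Complex.ofReal_zero).toSchwartzMap hgC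
  have hφ (ξ : E) : φ ξ = g ξ := rfl
  have h := DFunLike.congr_fun (congrArg (𝓕 ·) hv) φ
  rw [TemperedDistribution.fourier_lineDerivOp_eq, Lp.fourier_toTemperedDistribution_eq,
    Lp.fourier_toTemperedDistribution_eq, smul_apply,
    TemperedDistribution.smulLeftCLM_apply_apply, Lp.toTemperedDistribution_apply,
    Lp.toTemperedDistribution_apply, ← integral_smul] at h
  refine (h.symm.trans (integral_congr_ae (Eventually.of_forall fun ξ => ?_)))
  simp only [SchwartzMap.smulLeftCLM_apply_apply (F := ℂ) hm, hφ, smul_eq_mul, Complex.real_smul]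
  ring

end WeakDerivative

/-! ### Density of test functions and Sobolev embedding -/

theorem tendsto_mul_of_norm_le {α ι : Type*} {mα : MeasurableSpace α} {μ : Measure α}
    {l : Filter ι} {m : α → ℂ} {C : ℝ} {f F : ι → Lp ℂ 2 μ} {f₀ F₀ : Lp ℂ 2 μ}
    (hC : ∀ x, ‖m x‖ ≤ C) (hf : Tendsto f l (𝓝 f₀)) (hF : ∀ i, F i =ᵐ[μ] fun x => m x * f i x)
    (hF₀ : F₀ =ᵐ[μ] fun x => m x * f₀ x) : Tendsto F l (𝓝 F₀) := by
  rw [tendsto_iff_norm_sub_tendsto_zero] at hf ⊢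
  refine squeeze_zero (fun _ => norm_nonneg _) (fun i => ?_) (by simpa using hf.const_mul C)
  refine Lp.norm_le_mul_norm_of_ae_le_mul ?_
  filter_upwards [hF i, hF₀, Lp.coeFn_sub (F i) F₀, Lp.coeFn_sub (f i) f₀] with x h₁ h₂ h₃ h₄
  rw [h₃, h₄, Pi.sub_apply, Pi.sub_apply, h₁, h₂, ← mul_sub, norm_mul]
  exact mul_le_mul_of_nonneg_right (hC x) (norm_nonneg _)

section Weight

variable {E ι : Type*} [NormedAddCommGroup E]

/-- The weight `(1 + |ξ|²)^{-1/2}`. -/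
def weight (ξ : E) : ℝ := (1 + ‖ξ‖ ^ 2) ^ (-(1 / 2) : ℝ)

theorem weight_pos (ξ : E) : 0 < weight ξ := by
  unfold weight
  positivity

theorem weight_sq (ξ : E) : weight ξ ^ 2 * (1 + ‖ξ‖ ^ 2) = 1 := by
  have h : 0 < 1 + ‖ξ‖ ^ 2 := by positivity
  rw [weight, ← Real.rpow_mul_natCast h.le]
  norm_num
  rw [Real.rpow_neg_one, inv_mul_cancel₀ h.ne']

theorem weight_le_one (ξ : E) : weight ξ ≤ 1 := by
  nlinarith [weight_sq ξ, weight_pos ξ, sq_nonneg (weight ξ * ‖ξ‖)]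

variable [InnerProductSpace ℝ E]

theorem hasTemperateGrowth_weight : (weight (E := E)).HasTemperateGrowth :=
  Function.hasTemperateGrowth_one_add_norm_sq_rpow E _

theorem weight_mul_abs_inner_le_one [Fintype ι] (b : OrthonormalBasis ι ℝ E) (i : ι) (ξ : E) :
    weight ξ * |⟪ξ, b i⟫_ℝ| ≤ 1 := by
  have h : |⟪ξ, b i⟫_ℝ| ≤ ‖ξ‖ := by
    simpa using abs_real_inner_le_norm ξ (b i)
  have h' : weight ξ * ‖ξ‖ ≤ 1 := by
    nlinarith [weight_sq ξ, weight_pos ξ, norm_nonneg ξ, sq_nonneg (weight ξ)]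
  exact (mul_le_mul_of_nonneg_left h (weight_pos ξ).le).trans h'

end Weight

section Density

variable {E ι : Type*} [NormedAddCommGroup E] [InnerProductSpace ℝ E] [FiniteDimensional ℝ E]

section Truncate

variable (χ : ContDiffBump (0 : E))

theorem hasCompactSupport_bump_smul_mul {r : ℝ} (hr : r ≠ 0) (f : E → ℂ) :
    HasCompactSupport fun x => (χ (r • x) : ℂ) * f x :=
  ((χ.hasCompactSupport.comp_homeomorph (Homeomorph.smulOfNeZero r hr)).comp_left
    Complex.ofReal_zero).mul_right

/-- The truncation `x ↦ χ (r x) f x` of a Schwartz function. -/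
def truncate {r : ℝ} (hr : r ≠ 0) (f : 𝓢(E, ℂ)) : 𝓢(E, ℂ) :=
  (hasCompactSupport_bump_smul_mul χ hr f).toSchwartzMap
    ((Complex.ofRealCLM.contDiff.comp (χ.contDiff.comp (contDiff_const_smul r))).mul f.smooth')

theorem lineDeriv_truncate {r : ℝ} (hr : r ≠ 0) (f : 𝓢(E, ℂ)) (m x : E) :
    (∂_{m} (truncate χ hr f)) x =
      χ (r • x) * (∂_{m} f) x + (r * fderiv ℝ χ (r • x) m : ℝ) * f x := by
  have hχ : HasFDerivAt (fun y => χ (r • y))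
      ((fderiv ℝ χ (r • x)).comp (r • ContinuousLinearMap.id ℝ E)) x :=
    ((χ.contDiff (n := 1)).differentiable one_ne_zero _).hasFDerivAt.comp x
      ((hasFDerivAt_id x).const_smul r)
  have h := ((Complex.ofRealCLM.hasFDerivAt.comp x hχ).mul
    (f.differentiableAt (x := x)).hasFDerivAt).fderiv
  refine (congrArg (fun L => L m) h).trans ?_
  simp [SchwartzMap.lineDerivOp_apply_eq_fderiv, mul_comm]

theorem norm_bump_le_one (x : E) : ‖(χ x : ℂ)‖ ≤ 1 := by
  rw [Complex.norm_real, Real.norm_of_nonneg χ.nonneg]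
  exact χ.le_one

theorem tendsto_bump_smul {r : ℕ → ℝ} (hr₀ : Tendsto r atTop (𝓝 0)) (x : E) :
    Tendsto (fun n => (χ (r n • x) : ℂ)) atTop (𝓝 1) := by
  have hrx : Tendsto (fun n => r n • x) atTop (𝓝 0) := by
    simpa using hr₀.smul_const x
  have h := (Complex.continuous_ofReal.comp χ.continuous).tendsto 0 |>.comp hrx
  rwa [Function.comp_apply,
    χ.one_of_mem_closedBall (Metric.mem_closedBall_self χ.rIn_pos.le), Complex.ofReal_one] at h

variable [MeasurableSpace E] [BorelSpace E] {r : ℕ → ℝ} (hr : ∀ n, r n ≠ 0)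

theorem tendsto_toLp_truncate (hr₀ : Tendsto r atTop (𝓝 0)) (f : 𝓢(E, ℂ)) :
    Tendsto (fun n => (truncate χ (hr n) f).toLp 2) atTop (𝓝 (f.toLp 2 : L²(E))) := by
  refine tendsto_of_tendsto_multiplier (m := fun n x => (χ (r n • x) : ℂ)) (m₀ := fun _ => 1)
    (F₀ := f.toLp 2) (f := f.toLp 2) (fun n => ?_) (by simp)
    (fun n x => norm_bump_le_one χ _) (by simp)
    (Eventually.of_forall (tendsto_bump_smul χ hr₀))
  filter_upwards [(truncate χ (hr n) f).coeFn_toLp 2, f.coeFn_toLp 2] with x h₁ h₂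
  rw [h₁, h₂]
  rfl

theorem tendsto_toLp_lineDeriv_truncate (hr₀ : Tendsto r atTop (𝓝 0)) (hr₁ : ∀ n, ‖r n‖ ≤ 1)
    (f : 𝓢(E, ℂ)) (m : E) :
    Tendsto (fun n => (∂_{m} (truncate χ (hr n) f)).toLp 2) atTop
      (𝓝 ((∂_{m} f).toLp 2 : L²(E))) := by
  have hdχ : Continuous (fderiv ℝ χ) := (χ.contDiff (n := 1)).continuous_fderiv one_ne_zero
  obtain ⟨K, hK⟩ := (χ.hasCompactSupport.fderiv (𝕜 := ℝ)).exists_bound_of_continuous hdχ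
  let k (n : ℕ) (x : E) : ℂ := (r n * fderiv ℝ χ (r n • x) m : ℝ)
  have hk (n : ℕ) (x : E) : ‖k n x‖ ≤ K * ‖m‖ := by
    rw [Complex.norm_real, norm_mul, ← one_mul (K * ‖m‖)]
    exact mul_le_mul (hr₁ n) ((fderiv ℝ χ _).le_of_opNorm_le (hK _) m) (norm_nonneg _) zero_le_one
  have hlim (x : E) : Tendsto (fun n => k n x) atTop (𝓝 0) := by
    have hrx := hr₀.smul_const x
    have h := (hdχ.clm_apply (continuous_const (y := m))).tendsto _ |>.comp hrx
    simpa [k] using (hr₀.mul h).ofReal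
  have hcont (n : ℕ) : Continuous (k n) := by fun_prop
  have hmem (n : ℕ) := memLp_mul_of_norm_le (hcont n).aestronglyMeasurable
    (Eventually.of_forall (hk n)) (f.toLp 2)
  have hzero : Tendsto (fun n => (hmem n).toLp _) atTop (𝓝 0) :=
    tendsto_of_tendsto_multiplier (m₀ := 0) (fun n => (hmem n).coeFn_toLp)
      (by simpa using! Lp.coeFn_zero ℂ 2 volume) hk
      (by simpa using (norm_nonneg _).trans (hk 0 0)) (Eventually.of_forall hlim)
  have h := (tendsto_toLp_truncate χ hr hr₀ (∂_{m} f)).add hzero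
  rw [add_zero] at h
  refine h.congr fun n => Lp.ext ?_
  filter_upwards [(∂_{m} (truncate χ (hr n) f)).coeFn_toLp 2, f.coeFn_toLp 2, (hmem n).coeFn_toLp,
    (truncate χ (hr n) (∂_{m} f)).coeFn_toLp 2,
    Lp.coeFn_add ((truncate χ (hr n) (∂_{m} f)).toLp 2) ((hmem n).toLp _)] with x h₁ h₂ h₃ h₄ h₅
  rw [h₁, lineDeriv_truncate, h₅, Pi.add_apply, h₃, h₄, h₂]
  rfl

end Truncate

variable [MeasurableSpace E] [BorelSpace E] [Fintype ι]

/-- The compactly supported smooth functions together with their partial derivatives along `b`. -/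
def testGraph (b : OrthonormalBasis ι ℝ E) : Set (L²(E) × (ι → L²(E))) :=
  {F | ∃ g : 𝓢(E, ℂ), HasCompactSupport g ∧ F = (g.toLp 2, fun i => (∂_{b i} g).toLp 2)}

theorem toLp_mem_closure_testGraph (b : OrthonormalBasis ι ℝ E) (f : 𝓢(E, ℂ)) :
    (⟨f.toLp 2, fun i => (∂_{b i} f).toLp 2⟩ : L²(E) × (ι → L²(E))) ∈ closure (testGraph b) := by
  let χ : ContDiffBump (0 : E) := ⟨1, 2, one_pos, one_lt_two⟩
  let r (n : ℕ) : ℝ := 1 / (n + 1)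
  have hr (n : ℕ) : r n ≠ 0 := by positivity
  have hr₀ : Tendsto r atTop (𝓝 0) := tendsto_one_div_add_atTop_nhds_zero_nat
  have hr₁ (n : ℕ) : ‖r n‖ ≤ 1 := by
    rw [Real.norm_of_nonneg (by positivity)]
    exact div_le_one_of_le₀ (by simp) (by positivity)
  have h := (tendsto_toLp_truncate χ hr hr₀ f).prodMk_nhds
    (tendsto_pi_nhds.2 fun i => tendsto_toLp_lineDeriv_truncate χ hr hr₀ hr₁ f (b i))
  refine mem_closure_of_tendsto h (Eventually.of_forall fun n => ?_)
  exact ⟨truncate χ (hr n) f, hasCompactSupport_bump_smul_mul χ (hr n) f, rfl⟩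

theorem memLp_inv_weight_mul (b : OrthonormalBasis ι ℝ E) {u : L²(E)} {v : ι → L²(E)}
    (h : ∀ i, HasWeakDeriv (b i) u (v i)) :
    MemLp (fun ξ => ((weight ξ)⁻¹ : ℂ) * (𝓕 u : L²(E)) ξ) 2 volume := by
  have hg : MemLp (fun ξ => ‖(𝓕 u : L²(E)) ξ‖ + ∑ i, ‖(𝓕 (v i) : L²(E)) ξ‖) 2 volume :=
    (Lp.memLp _).norm.add (memLp_finsetSum _ fun i _ => (Lp.memLp _).norm)
  have hw : Continuous fun ξ : E => ((weight ξ)⁻¹ : ℂ) := by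
    refine Continuous.inv₀ (Complex.continuous_ofReal.comp hasTemperateGrowth_weight.1.continuous)
      fun ξ => Complex.ofReal_ne_zero.2 (weight_pos ξ).ne'
  refine hg.of_le (hw.aestronglyMeasurable.mul (Lp.aestronglyMeasurable _)) ?_
  filter_upwards [ae_all_iff.2 h] with ξ hξ
  have hsum : (weight ξ)⁻¹ ≤ 1 + ∑ i, 2 * π * |⟪ξ, b i⟫_ℝ| := by
    have hinv : (weight ξ)⁻¹ = weight ξ + ∑ i, weight ξ * |⟪ξ, b i⟫_ℝ| * |⟪ξ, b i⟫_ℝ| := by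
      simp only [mul_assoc, ← Finset.mul_sum, ← pow_two, sq_abs, b.sum_sq_inner_left]
      have := weight_pos ξ
      field_simp
      linarith [weight_sq ξ]
    rw [hinv]
    refine add_le_add (weight_le_one ξ) (Finset.sum_le_sum fun i _ => ?_)
    exact mul_le_mul_of_nonneg_right
      ((weight_mul_abs_inner_le_one b i ξ).trans (by linarith [two_le_pi])) (abs_nonneg _)
  have hv (i : ι) : ‖(𝓕 (v i) : L²(E)) ξ‖ = 2 * π * |⟪ξ, b i⟫_ℝ| * ‖(𝓕 u : L²(E)) ξ‖ := by
    simp [hξ i, abs_of_pos pi_pos]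
  rw [norm_mul, norm_inv, Complex.norm_real, Real.norm_of_nonneg (weight_pos ξ).le,
    Real.norm_of_nonneg (by positivity)]
  simp only [hv, ← Finset.sum_mul]
  rw [← one_add_mul]
  exact mul_le_mul_of_nonneg_right hsum (norm_nonneg _)

theorem mem_closure_testGraph (b : OrthonormalBasis ι ℝ E) {u : L²(E)} {v : ι → L²(E)}
    (h : ∀ i, HasWeakDeriv (b i) u (v i)) : (u, v) ∈ closure (testGraph b) := by
  have hmem := memLp_inv_weight_mul b h
  obtain ⟨W, hWs, hW⟩ := mem_closure_iff_seq_limit.1 ((SchwartzMap.denseRange_toLpCLM (F := ℂ)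
    (μ := (volume : Measure E)) (p := 2) ENNReal.ofNat_ne_top) (hmem.toLp _))
  choose φ hφ using hWs
  have hw : (fun ξ : E => (weight ξ : ℂ)).HasTemperateGrowth := by
    have := hasTemperateGrowth_weight (E := E)
    fun_prop
  let g (n : ℕ) : 𝓢(E, ℂ) := 𝓕⁻ (SchwartzMap.smulLeftCLM ℂ (fun ξ : E => (weight ξ : ℂ)) (φ n))
  have hg (n : ℕ) : (𝓕 ((g n).toLp 2) : L²(E)) =ᵐ[volume] fun ξ => (weight ξ : ℂ) * W n ξ := by
    rw [SchwartzMap.toLp_fourier_eq, fourier_fourierInv_eq, ← hφ n]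
    filter_upwards [SchwartzMap.coeFn_toLp
      (SchwartzMap.smulLeftCLM ℂ (fun ξ : E => (weight ξ : ℂ)) (φ n)) 2,
      (φ n).coeFn_toLp 2] with ξ h₁ h₂
    rw [h₁, SchwartzMap.smulLeftCLM_apply_apply hw, SchwartzMap.toLpCLM_apply, h₂, smul_eq_mul]
  have hu : (𝓕 u : L²(E)) =ᵐ[volume] fun ξ => (weight ξ : ℂ) * hmem.toLp _ ξ := by
    filter_upwards [hmem.coeFn_toLp] with ξ hξ
    rw [hξ, mul_inv_cancel_left₀ (Complex.ofReal_ne_zero.2 (weight_pos ξ).ne')]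
  have hgu : Tendsto (fun n => ((g n).toLp 2 : L²(E))) atTop (𝓝 u) :=
    tendsto_of_tendsto_fourier <| tendsto_mul_of_norm_le (m := fun ξ => (weight ξ : ℂ)) (C := 1)
      (fun ξ => by simpa [abs_of_pos (weight_pos ξ)] using weight_le_one ξ) hW hg hu
  have hgv (i : ι) : Tendsto (fun n => ((∂_{b i} (g n)).toLp 2 : L²(E))) atTop (𝓝 (v i)) := by
    refine tendsto_of_tendsto_fourier <| tendsto_mul_of_norm_le (C := 2 * π)
      (m := fun ξ => 2 * π * ⟪ξ, b i⟫_ℝ * Complex.I * weight ξ) (fun ξ => ?_) hW (fun n => ?_) ?_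
    · have h := mul_le_mul_of_nonneg_left (weight_mul_abs_inner_le_one b i ξ) two_pi_pos.le
      simpa [abs_of_pos pi_pos, abs_of_pos (weight_pos ξ), mul_assoc, mul_left_comm, mul_comm]
        using h
    · filter_upwards [hasWeakDeriv_toLp (b i) (g n), hg n] with ξ h₁ h₂
      rw [h₁, h₂, ← mul_assoc]
    · filter_upwards [h i, hu] with ξ h₁ h₂
      rw [h₁, h₂, ← mul_assoc]
  rw [← closure_closure]
  exact mem_closure_of_tendsto (hgu.prodMk_nhds (tendsto_pi_nhds.2 hgv))
    (Eventually.of_forall fun n => toLp_mem_closure_testGraph b (g n))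

end Density

section Embedding

variable {E ι : Type*} [NormedAddCommGroup E] [InnerProductSpace ℝ E] [Fintype ι]

theorem opNorm_le_sum_norm_apply {F : Type*} [NormedAddCommGroup F] [NormedSpace ℝ F]
    (b : OrthonormalBasis ι ℝ E) (L : E →L[ℝ] F) : ‖L‖ ≤ ∑ i, ‖L (b i)‖ := by
  refine L.opNorm_le_bound (Finset.sum_nonneg fun i _ => norm_nonneg _) fun x => ?_
  conv_lhs => rw [← b.sum_repr' x, map_sum]
  refine (norm_sum_le _ _).trans ?_
  rw [Finset.sum_mul]
  refine Finset.sum_le_sum fun i _ => ?_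
  rw [map_smul, norm_smul, mul_comm]
  gcongr
  simpa using norm_inner_le_norm (𝕜 := ℝ) (b i) x

variable [FiniteDimensional ℝ E] [MeasurableSpace E] [BorelSpace E]

theorem eLpNorm_toLp_lineDeriv (m : E) (g : 𝓢(E, ℂ)) :
    eLpNorm (fun x => ‖fderiv ℝ g x m‖) 2 volume = ‖((∂_{m} g).toLp 2 : L²(E))‖ₑ := by
  simp only [Lp.enorm_def, eLpNorm_congr_ae ((∂_{m} g).coeFn_toLp 2 volume), ← eLpNorm_norm
    (∂_{m} g : 𝓢(E, ℂ)), SchwartzMap.lineDerivOp_apply_eq_fderiv]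

theorem eLpNorm_fderiv_le (b : OrthonormalBasis ι ℝ E) (g : 𝓢(E, ℂ)) :
    eLpNorm (fderiv ℝ g) 2 volume ≤ ∑ i, ‖((∂_{b i} g).toLp 2 : L²(E))‖ₑ := by
  have hcont (i : ι) : Continuous fun x => ‖fderiv ℝ g x (b i)‖ :=
    (((g.smooth 1).continuous_fderiv one_ne_zero).clm_apply continuous_const).norm
  simp only [← eLpNorm_toLp_lineDeriv]
  refine (eLpNorm_mono_real fun x => ?_).trans
    (eLpNorm_sum_le (fun i _ => (hcont i).aestronglyMeasurable) one_le_two)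
  simpa using opNorm_le_sum_norm_apply b (fderiv ℝ g x)

theorem exists_eLpNorm_pow_succ_succ_le (hE : Module.finrank ℝ E = 2) :
    ∃ C : NNReal, ∀ {g : 𝓢(E, ℂ)}, HasCompactSupport g → ∀ k : ℕ,
      eLpNorm (fun x => g x ^ (k + 2)) 2 volume ≤ C * (‖(k + 2 : ℂ)‖ₑ *
        (eLpNorm (fun x => g x ^ (k + 1)) 2 volume * eLpNorm (fderiv ℝ g) 2 volume)) := by
  have hp : NNReal.HolderConjugate (Module.finrank ℝ E) 2 := by
    rw [hE]
    exact_mod_cast NNReal.HolderConjugate.two_two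
  refine ⟨eLpNormLESNormFDerivOneConst (volume : Measure E) (2 : NNReal), fun {g} hg k => ?_⟩
  have hpow : HasCompactSupport fun x => g x ^ (k + 2) :=
    hg.comp_left (g := fun z : ℂ => z ^ (k + 2)) (zero_pow (by simp))
  have hderiv : (fderiv ℝ fun x => g x ^ (k + 2)) =
      ((k + 2 : ℂ) • fun x => g x ^ (k + 1)) • fderiv ℝ g := by
    ext1 x
    rw [fderiv_fun_pow (k + 2) g.differentiableAt]
    simp [mul_smul]
  refine (eLpNorm_le_eLpNorm_fderiv_one volume ((g.smooth 1).pow (k + 2)) hpow hp).trans ?_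
  rw [hderiv, ← mul_assoc ‖(k + 2 : ℂ)‖ₑ, ← eLpNorm_const_smul]
  gcongr
  exact eLpNorm_smul_le_mul_eLpNorm
    ((g.smooth 1).continuous_fderiv one_ne_zero).aestronglyMeasurable
    ((g.continuous.pow (k + 1)).const_smul (k + 2 : ℂ)).aestronglyMeasurable

theorem exists_eLpNorm_pow_le_of_hasCompactSupport (hE : Module.finrank ℝ E = 2)
    (b : OrthonormalBasis ι ℝ E) (k : ℕ) :
    ∃ C : NNReal, ∀ {g : 𝓢(E, ℂ)}, HasCompactSupport g →
      eLpNorm (fun x => g x ^ (k + 1)) 2 volume ≤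
        C * (‖(g.toLp 2 : L²(E))‖ₑ * (∑ i, ‖((∂_{b i} g).toLp 2 : L²(E))‖ₑ) ^ k) := by
  induction k with
  | zero =>
    refine ⟨1, fun {g} _ => ?_⟩
    simp [Lp.enorm_def, eLpNorm_congr_ae (g.coeFn_toLp 2)]
  | succ k ih =>
    obtain ⟨C, hC⟩ := ih
    obtain ⟨K, hK⟩ := exists_eLpNorm_pow_succ_succ_le hE
    refine ⟨K * ‖(k + 2 : ℂ)‖₊ * C, fun {g} hg => ?_⟩
    have hmul := mul_le_mul' (hC hg) (eLpNorm_fderiv_le b g)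
    refine (hK hg k).trans ?_
    rw [enorm_eq_nnnorm (k + 2 : ℂ), ← mul_assoc, ENNReal.coe_mul, mul_assoc _ (C : ℝ≥0∞),
      ENNReal.coe_mul, pow_succ, ← mul_assoc ‖_‖ₑ, ← mul_assoc (C : ℝ≥0∞)]
    exact mul_le_mul_right hmul _

theorem isClosed_setOf_eLpNorm_pow_le {α β : Type*} {mα : MeasurableSpace α} {μ : Measure α}
    [TopologicalSpace β] [FirstCountableTopology β] {f : β → Lp ℂ 2 μ} (hf : Continuous f)
    {B : β → ℝ≥0∞} (hB : Continuous B) (k : ℕ) :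
    IsClosed {y | eLpNorm (fun x => f y x ^ k) 2 μ ≤ B y} := by
  refine IsSeqClosed.isClosed fun y y₀ hy hlim => ?_
  obtain ⟨ns, hns, hae⟩ := (tendstoInMeasure_of_tendsto_Lp
    ((hf.tendsto y₀).comp hlim)).exists_seq_tendsto_ae
  calc eLpNorm (fun x => f y₀ x ^ k) 2 μ
      ≤ liminf (fun n => eLpNorm (fun x => f (y (ns n)) x ^ k) 2 μ) atTop := by
        refine Lp.eLpNorm_lim_le_liminf_eLpNorm
          (fun n => (Lp.aestronglyMeasurable _).pow k) _ ?_
        filter_upwards [hae] with x hx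
        exact hx.pow k
    _ ≤ liminf (fun n => B (y (ns n))) atTop :=
      liminf_le_liminf (Eventually.of_forall fun n => hy _)
    _ = B y₀ := ((hB.tendsto y₀).comp (hlim.comp hns.tendsto_atTop)).liminf_eq

theorem exists_eLpNorm_pow_le (hE : Module.finrank ℝ E = 2) (b : OrthonormalBasis ι ℝ E) (k : ℕ) :
    ∃ C : NNReal, ∀ {u : L²(E)} {v : ι → L²(E)}, (∀ i, HasWeakDeriv (b i) u (v i)) →
      eLpNorm (fun x => u x ^ (k + 1)) 2 volume ≤ C * (‖u‖ₑ * (∑ i, ‖v i‖ₑ) ^ k) := by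
  obtain ⟨C, hC⟩ := exists_eLpNorm_pow_le_of_hasCompactSupport hE b k
  refine ⟨C, fun {u v} h => ?_⟩
  have hclosed : IsClosed {F : L²(E) × (ι → L²(E)) | eLpNorm (fun x => F.1 x ^ (k + 1)) 2 volume ≤
      ↑(C * (‖F.1‖₊ * (∑ i, ‖F.2 i‖₊) ^ k))} :=
    isClosed_setOf_eLpNorm_pow_le continuous_fst (ENNReal.continuous_coe.comp (by fun_prop)) (k + 1)
  have hsub : testGraph b ⊆ {F : L²(E) × (ι → L²(E)) |
      eLpNorm (fun x => F.1 x ^ (k + 1)) 2 volume ≤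
      ↑(C * (‖F.1‖₊ * (∑ i, ‖F.2 i‖₊) ^ k))} := by
    rintro _ ⟨g, hg, rfl⟩
    have hg' := eLpNorm_congr_ae (p := 2) ((g.coeFn_toLp 2 volume).fun_comp (· ^ (k + 1)))
    simpa [enorm_eq_nnnorm, Function.comp_def] using hg'.trans_le (hC hg)
  simpa [enorm_eq_nnnorm] using closure_minimal hsub hclosed (mem_closure_testGraph b h)

theorem memLp_norm_pow_succ (hE : Module.finrank ℝ E = 2) (b : OrthonormalBasis ι ℝ E)
    {u : L²(E)} {v : ι → L²(E)} (h : ∀ i, HasWeakDeriv (b i) u (v i)) (k : ℕ) :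
    MemLp (fun x => ‖u x‖ ^ (k + 1)) 2 volume := by
  obtain ⟨C, hC⟩ := exists_eLpNorm_pow_le hE b k
  have hpow : MemLp (fun x => u x ^ (k + 1)) 2 volume := by
    refine ⟨(Lp.aestronglyMeasurable u).pow _, (hC h).trans_lt ?_⟩
    exact ENNReal.mul_lt_top ENNReal.coe_lt_top (ENNReal.mul_lt_top enorm_lt_top
      (ENNReal.pow_lt_top (ENNReal.sum_lt_top.2 fun i _ => enorm_lt_top)))
  simpa only [norm_pow] using hpow.norm

theorem memLp_norm_rpow (hE : Module.finrank ℝ E = 2) (b : OrthonormalBasis ι ℝ E)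
    {u : L²(E)} {v : ι → L²(E)} (h : ∀ i, HasWeakDeriv (b i) u (v i)) {p : ℝ} (hp : 1 ≤ p) :
    MemLp (fun x => ‖u x‖ ^ p) 2 volume := by
  refine ((Lp.memLp u).norm.add (memLp_norm_pow_succ hE b h ⌈p⌉₊)).of_le
    ((Lp.aestronglyMeasurable u).norm.aemeasurable.pow_const p).aestronglyMeasurable
    (Eventually.of_forall fun x => ?_)
  rw [Pi.add_apply, Real.norm_of_nonneg (by positivity), Real.norm_of_nonneg (by positivity)]
  rcases le_total ‖u x‖ 1 with hx | hx
  · exact (rpow_le_self_of_le_one (norm_nonneg _) hx hp).trans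
      (le_add_of_nonneg_right (by positivity))
  · refine le_add_of_nonneg_of_le (norm_nonneg _) ?_
    rw [← rpow_natCast]
    exact rpow_le_rpow_of_exponent_le hx ((Nat.le_ceil p).trans (by simp))

theorem memLp_ofReal_norm_sq (hE : Module.finrank ℝ E = 2) (b : OrthonormalBasis ι ℝ E)
    {u : L²(E)} {v : ι → L²(E)} (h : ∀ i, HasWeakDeriv (b i) u (v i)) :
    MemLp (fun x => ((‖u x‖ ^ 2 : ℝ) : ℂ)) 2 volume :=
  (memLp_norm_pow_succ hE b h 1).ofReal

theorem exists_eLpNorm_four_sq_le (hE : Module.finrank ℝ E = 2) (b : OrthonormalBasis ι ℝ E) :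
    ∃ C : NNReal, ∀ {u : L²(E)} {v : ι → L²(E)}, (∀ i, HasWeakDeriv (b i) u (v i)) →
      MemLp u 4 volume ∧ (eLpNorm u 4 volume).toReal ^ 2 ≤ C * (‖u‖ * ∑ i, ‖v i‖) := by
  obtain ⟨C, hC⟩ := exists_eLpNorm_pow_le hE b 1
  refine ⟨C, fun {u v} h => ?_⟩
  have hfour : eLpNorm (fun x => u x ^ 2) 2 volume = eLpNorm u 4 volume ^ 2 := by
    rw [← eLpNorm_norm]
    have := eLpNorm_norm_rpow (p := 2) (μ := volume) u (two_pos (α := ℝ))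
    norm_num at this
    simpa using this
  have hle : eLpNorm u 4 volume ^ 2 ≤ ↑(C * (‖u‖₊ * ∑ i, ‖v i‖₊)) := by
    simpa [← hfour, enorm_eq_nnnorm] using hC h
  refine ⟨⟨Lp.aestronglyMeasurable u, ?_⟩, ?_⟩
  · exact (ENNReal.pow_lt_top_iff.1 (hle.trans_lt ENNReal.coe_lt_top)).resolve_right two_ne_zero
  · simpa [-ENNReal.coe_mul, NNReal.coe_sum] using
      ENNReal.toReal_mono ENNReal.coe_ne_top hle

theorem memLp_four (hE : Module.finrank ℝ E = 2) (b : OrthonormalBasis ι ℝ E) {u : L²(E)}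
    {v : ι → L²(E)} (h : ∀ i, HasWeakDeriv (b i) u (v i)) : MemLp u 4 volume :=
  ((exists_eLpNorm_four_sq_le hE b).choose_spec h).1

end Embedding

/-! ### The weak form of the equation -/

section QuarticForm

variable {α : Type*} {mα : MeasurableSpace α} {μ : Measure α} {V u u' w w' : Lp ℂ 2 μ}

/-- The pairing `∫ V u w̄`, which is finite for `V ∈ L²` and `u, w ∈ L⁴`. -/
def quarticForm (V u w : Lp ℂ 2 μ) : ℂ := ∫ x, V x * (u x * conj (w x)) ∂μ

theorem holderTriple_four : ENNReal.HolderTriple 4 4 2 := by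
  refine ⟨?_⟩
  rw [← two_mul, show (4 : ℝ≥0∞) = 2 * 2 by norm_num, ENNReal.mul_inv (by simp) (by simp),
    ← mul_assoc, ENNReal.mul_inv_cancel (by simp) (by simp), one_mul]

theorem integrable_quarticForm (hu : MemLp u 4 μ) (hw : MemLp w 4 μ) :
    Integrable (fun x => V x * (u x * conj (w x))) μ := by
  have := holderTriple_four
  exact (Lp.memLp V).integrable_mul (hw.star.mul (r := 2) hu)

theorem norm_quarticForm_le (hu : MemLp u 4 μ) (hw : MemLp w 4 μ) :
    ‖quarticForm V u w‖ ≤ ‖V‖ * ((eLpNorm u 4 μ).toReal * (eLpNorm w 4 μ).toReal) := by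
  have := holderTriple_four
  have hP : MemLp (fun x => conj (u x) * w x) 2 μ := hw.mul hu.star
  have hinner : quarticForm V u w = ⟪hP.toLp _, V⟫_ℂ := by
    rw [quarticForm, L2.inner_def]
    refine integral_congr_ae ?_
    filter_upwards [hP.coeFn_toLp] with x hx
    simp [hx]
  rw [hinner, mul_comm]
  refine (norm_inner_le_norm _ _).trans (mul_le_mul_of_nonneg_right ?_ (norm_nonneg V))
  rw [Lp.norm_toLp, ← ENNReal.toReal_mul]
  refine ENNReal.toReal_mono (ENNReal.mul_ne_top hu.eLpNorm_ne_top hw.eLpNorm_ne_top) ?_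
  simpa using! eLpNorm_smul_le_mul_eLpNorm hw.1 hu.star.1 (p := 4) (r := 2)

theorem quarticForm_sub_left (hu : MemLp u 4 μ) (hu' : MemLp u' 4 μ) (hw : MemLp w 4 μ) :
    quarticForm V (u - u') w = quarticForm V u w - quarticForm V u' w := by
  rw [quarticForm, quarticForm, quarticForm, ← integral_sub (integrable_quarticForm hu hw)
    (integrable_quarticForm hu' hw)]
  refine integral_congr_ae ?_
  filter_upwards [Lp.coeFn_sub u u'] with x hx
  rw [hx, Pi.sub_apply]
  ring

theorem conj_quarticForm (hV : ∀ᵐ x ∂μ, conj (V x) = V x) :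
    conj (quarticForm V u w) = quarticForm V w u := by
  rw [quarticForm, quarticForm, ← integral_conj]
  refine integral_congr_ae ?_
  filter_upwards [hV] with x hx
  simp [hx, mul_comm]

theorem quarticForm_sub_right (hu : MemLp u 4 μ) (hw : MemLp w 4 μ) (hw' : MemLp w' 4 μ) :
    quarticForm V u (w - w') = quarticForm V u w - quarticForm V u w' := by
  rw [quarticForm, quarticForm, quarticForm, ← integral_sub (integrable_quarticForm hu hw)
    (integrable_quarticForm hu hw')]
  refine integral_congr_ae ?_
  filter_upwards [Lp.coeFn_sub w w'] with x hx
  rw [hx, Pi.sub_apply, map_sub]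
  ring

/-- Polarization around `u`: the quartic form of a difference of two functions close to `u` is a
difference of diagonal values, up to terms that are quadratic in the distance to `u`. -/
theorem two_mul_re_quarticForm_sub (hV : ∀ᵐ x ∂μ, conj (V x) = V x) (hu : MemLp u 4 μ)
    (hw : MemLp w 4 μ) (hw' : MemLp w' 4 μ) :
    2 * (quarticForm V u (w - w')).re =
      (quarticForm V w w).re - (quarticForm V w' w').re -
        ((quarticForm V (w - u) (w - u)).re - (quarticForm V (w' - u) (w' - u)).re) := by
  have hsub {a : Lp ℂ 2 μ} (ha : MemLp a 4 μ) : MemLp (a - u : Lp ℂ 2 μ) 4 μ :=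
    (ha.sub hu).ae_eq (Lp.coeFn_sub a u).symm
  have hsymm (a : Lp ℂ 2 μ) : (quarticForm V a u).re = (quarticForm V u a).re := by
    rw [← conj_quarticForm hV, Complex.conj_re]
  rw [quarticForm_sub_right hu hw hw', quarticForm_sub_left hw hu (hsub hw),
    quarticForm_sub_left hw' hu (hsub hw'), quarticForm_sub_right hw hw hu,
    quarticForm_sub_right hu hw hu, quarticForm_sub_right hw' hw' hu,
    quarticForm_sub_right hu hw' hu]
  simp only [Complex.sub_re, hsymm]
  ring

end QuarticForm

section Reflection

variable {E : Type*} [NormedAddCommGroup E] [InnerProductSpace ℝ E] [FiniteDimensional ℝ E]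
  [MeasurableSpace E] [BorelSpace E]

/-- The reflection `f ↦ f (-·)` of `L²`. -/
def reflect : L²(E) →ₗᵢ[ℂ] L²(E) :=
  Lp.compMeasurePreservingₗᵢ ℂ (fun x : E => -x) (Measure.measurePreserving_neg volume)

theorem coeFn_reflect (f : L²(E)) : reflect f =ᵐ[volume] fun x => f (-x) :=
  Lp.coeFn_compMeasurePreserving f (Measure.measurePreserving_neg volume)

/-- Complex conjugation on `L²`. -/
def conjugate : L²(E) →L[ℝ] L²(E) := (Complex.conjCLE : ℂ →L[ℝ] ℂ).compLpL 2 volume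

theorem coeFn_conjugate (f : L²(E)) : conjugate f =ᵐ[volume] fun x => conj (f x) :=
  (Complex.conjCLE : ℂ →L[ℝ] ℂ).coeFn_compLpL f

theorem fourier_conj_apply (φ : 𝓢(E, ℂ)) (ξ : E) :
    𝓕 (fun x => conj (φ x)) ξ = conj ((𝓕 φ) (-ξ)) := by
  rw [SchwartzMap.fourier_coe, Real.fourier_eq, Real.fourier_eq, ← integral_conj]
  refine integral_congr_ae (Eventually.of_forall fun x => ?_)
  simp [Circle.smul_def, ← Circle.coe_inv_eq_conj, AddChar.map_neg_eq_inv]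

theorem fourier_conjugate (f : L²(E)) : 𝓕 (conjugate f) = conjugate (reflect (𝓕 f)) := by
  induction f using schwartz_induction with
  | hP =>
    exact isClosed_eq (continuous_fourier.comp conjugate.continuous)
      (conjugate.continuous.comp (reflect.continuous.comp continuous_fourier))
  | h φ =>
    let ψ : 𝓢(E, ℂ) := φ.postcompCLM (Complex.conjCLE : ℂ →L[ℝ] ℂ)
    have hψ : conjugate (φ.toLp 2 : L²(E)) = ψ.toLp 2 := by
      refine Lp.ext ?_
      filter_upwards [coeFn_conjugate (φ.toLp 2), φ.coeFn_toLp 2, ψ.coeFn_toLp 2]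
        with x h₁ h₂ h₃
      simp [h₁, h₂, h₃, ψ]
    rw [hψ, SchwartzMap.toLp_fourier_eq, SchwartzMap.toLp_fourier_eq]
    refine Lp.ext ?_
    filter_upwards [(𝓕 ψ).coeFn_toLp 2, coeFn_reflect ((𝓕 φ).toLp 2),
      coeFn_conjugate (reflect ((𝓕 φ).toLp 2)),
      (Measure.measurePreserving_neg volume).quasiMeasurePreserving.ae
        ((𝓕 φ).coeFn_toLp 2 volume)] with ξ h₁ h₂ h₃ h₄
    rw [h₁, h₃, h₂, h₄, SchwartzMap.fourier_coe]
    exact fourier_conj_apply φ ξ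

end Reflection

theorem symbol_neg (ξ : Plane) : symbol (-ξ) = symbol ξ := by simp [symbol]

theorem fourier_E₁L2 (f : L2) :
    (𝓕 (E₁L2 f) : L2) =ᵐ[volume] fun ξ => (symbol ξ : ℂ) * (𝓕 f : L2) ξ := by
  rw [E₁L2, fourier_fourierInv_eq]
  exact (memLp_symbol_mul (𝓕 f)).coeFn_toLp

theorem conjugate_E₁L2 (f : L2) : conjugate (E₁L2 f) = E₁L2 (conjugate f) := by
  refine (Lp.fourierTransformₗᵢ Plane ℂ).injective (Lp.ext ?_)
  change (𝓕 (conjugate (E₁L2 f)) : L2) =ᵐ[volume] (𝓕 (E₁L2 (conjugate f)) : L2)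
  rw [fourier_conjugate]
  filter_upwards [coeFn_conjugate (reflect (𝓕 (E₁L2 f))), coeFn_reflect (𝓕 (E₁L2 f)),
    (Measure.measurePreserving_neg volume).quasiMeasurePreserving.ae (fourier_E₁L2 f),
    fourier_E₁L2 (conjugate f), fourier_conjugate f ▸ coeFn_conjugate (reflect (𝓕 f)),
    coeFn_reflect (𝓕 f)] with ξ h₁ h₂ h₃ h₄ h₅ h₆
  rw [h₁, h₂, h₃, h₄, h₅, h₆, symbol_neg]
  simp

section WeakForm

variable {E : Type*} [NormedAddCommGroup E] [InnerProductSpace ℝ E] [FiniteDimensional ℝ E]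
  [MeasurableSpace E] [BorelSpace E] {ι : Type*} [Fintype ι] {b : OrthonormalBasis ι ℝ E}

theorem inner_toLp_left (g : 𝓢(E, ℂ)) (f : L²(E)) :
    ⟪(g.toLp 2 : L²(E)), f⟫_ℂ = ∫ x, f x * conj (g x) := by
  rw [L2.inner_def]
  refine integral_congr_ae ?_
  filter_upwards [g.coeFn_toLp 2] with x hx
  rw [hx, RCLike.inner_apply]

theorem quarticForm_toLp_right (V u : L²(E)) (g : 𝓢(E, ℂ)) :
    quarticForm V u (g.toLp 2) = ∫ x, V x * (u x * conj (g x)) := by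
  refine integral_congr_ae ?_
  filter_upwards [g.coeFn_toLp 2] with x hx
  rw [hx]

theorem integral_mul_laplacian_conj {u : L²(E)} {v : ι → L²(E)}
    (hv : ∀ i, HasWeakDeriv (b i) u (v i)) (g : 𝓢(E, ℂ)) :
    ∫ x, u x * Laplacian.laplacian (fun y => conj (g y)) x =
      -∑ i, ⟪((∂_{b i} g).toLp 2 : L²(E)), v i⟫_ℂ := by
  have hconj : (fun y => conj (g y)) = Complex.conjCLE ∘ g := rfl
  have hint (i : ι) : Integrable (fun x => u x * conj ((∂_{b i} (∂_{b i} g)) x)) volume :=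
    (Lp.memLp u).integrable_mul ((∂_{b i} (∂_{b i} g)).memLp 2 volume).star
  rw [hconj]
  simp only [InnerProductSpace.laplacian_CLE_comp_left, Function.comp_apply,
    ← SchwartzMap.laplacian_apply, SchwartzMap.laplacian_eq_sum b, sum_apply, map_sum,
    Complex.conjCLE_apply, Finset.mul_sum]
  rw [integral_finsetSum _ fun i _ => hint i, ← Finset.sum_neg_distrib]
  refine Finset.sum_congr rfl fun i _ => ?_
  rw [← inner_toLp_left, (hasWeakDeriv_toLp (b i) (∂_{b i} g)).inner_left (hv i)]

theorem tendsto_quarticForm_right (hE : Module.finrank ℝ E = 2) {V u w : L²(E)}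
    {z : ι → L²(E)} {w' : ℕ → L²(E)} {z' : ℕ → ι → L²(E)}
    (hu : MemLp u 4 volume) (hw : ∀ i, HasWeakDeriv (b i) w (z i))
    (hw' : ∀ n i, HasWeakDeriv (b i) (w' n) (z' n i)) (hlim : Tendsto w' atTop (𝓝 w))
    (hlim' : Tendsto z' atTop (𝓝 z)) :
    Tendsto (fun n => quarticForm V u (w' n)) atTop (𝓝 (quarticForm V u w)) := by
  obtain ⟨C, hC⟩ := exists_eLpNorm_four_sq_le hE b
  have hdiff (n : ℕ) : ∀ i, HasWeakDeriv (b i) (w' n - w) ((z' n - z) i) :=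
    fun i => (hw' n i).sub (hw i)
  have hnorm : Tendsto (fun n => (eLpNorm (w' n - w : L²(E)) 4 volume).toReal) atTop (𝓝 0) := by
    have hbound : Tendsto (fun n => C * (‖w' n - w‖ * ∑ i, ‖(z' n - z) i‖)) atTop (𝓝 0) := by
      have h := ((tendsto_sub_nhds_zero_iff.2 hlim).norm.mul (tendsto_finsetSum Finset.univ
        fun i _ => (tendsto_pi_nhds.1 (tendsto_sub_nhds_zero_iff.2 hlim') i).norm)).const_mul
          (C : ℝ)
      simpa using h
    have hsq := squeeze_zero (fun n => sq_nonneg _) (fun n => (hC (hdiff n)).2) hbound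
    simpa using hsq.sqrt
  rw [tendsto_iff_norm_sub_tendsto_zero]
  have hbound : Tendsto (fun n => ‖V‖ * ((eLpNorm u 4 volume).toReal *
      (eLpNorm (w' n - w : L²(E)) 4 volume).toReal)) atTop (𝓝 0) := by
    simpa using (hnorm.const_mul _).const_mul ‖V‖
  refine squeeze_zero (fun n => norm_nonneg _) (fun n => ?_) hbound
  rw [← quarticForm_sub_right hu (hC (hw' n)).1 (hC hw).1]
  exact norm_quarticForm_le hu (hC (hdiff n)).1

end WeakForm

section Equation

variable {p ω : ℝ} {u N f : L2} {v : Fin 2 → L2} {b : OrthonormalBasis (Fin 2) ℝ Plane}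

theorem IsSolution.weakForm_toLp (hu : IsSolution p ω u)
    (hv : ∀ i, HasWeakDeriv (b i) u (v i))
    (hN : N =ᵐ[volume] fun x => ((‖u x‖ ^ (p - 1) : ℝ) : ℂ) * u x)
    (hf : f =ᵐ[volume] fun x => ((‖u x‖ ^ 2 : ℝ) : ℂ)) {g : 𝓢(Plane, ℂ)}
    (hg : HasCompactSupport g) :
    ∑ i, ⟪((∂_{b i} g).toLp 2 : L2), v i⟫_ℂ + ω * ⟪(g.toLp 2 : L2), u⟫_ℂ =
      ⟪(g.toLp 2 : L2), N⟫_ℂ + quarticForm (E₁L2 f) u (g.toLp 2) := by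
  have hE₁ : E₁ (fun y => ((‖u y‖ ^ 2 : ℝ) : ℂ)) = E₁L2 f := by
    have hmem : MemLp (fun y => ((‖u y‖ ^ 2 : ℝ) : ℂ)) 2 volume := (Lp.memLp f).ae_eq hf
    rw [E₁, dif_pos hmem, show hmem.toLp _ = f from Lp.ext (hmem.coeFn_toLp.trans hf.symm)]
  have h := hu.equation (fun x => conj (g x)) (Complex.conjCLE.contDiff.comp (g.smooth ⊤))
    (hg.comp_left (map_zero conj))
  rw [integral_mul_laplacian_conj hv, hE₁, ← inner_toLp_left] at h
  have hpow : ∫ x, ((‖u x‖ ^ (p - 1) : ℝ) : ℂ) * u x * conj (g x) =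
      ⟪(g.toLp 2 : L2), N⟫_ℂ := by
    rw [inner_toLp_left]
    refine integral_congr_ae ?_
    filter_upwards [hN] with x hx
    rw [hx]
  rw [hpow] at h
  simp only [mul_assoc, ← quarticForm_toLp_right] at h
  linear_combination -h

theorem IsSolution.weakForm (hu : IsSolution p ω u)
    (hv : ∀ i, HasWeakDeriv (b i) u (v i))
    (hN : N =ᵐ[volume] fun x => ((‖u x‖ ^ (p - 1) : ℝ) : ℂ) * u x)
    (hf : f =ᵐ[volume] fun x => ((‖u x‖ ^ 2 : ℝ) : ℂ)) {w : L2} {z : Fin 2 → L2}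
    (hw : ∀ i, HasWeakDeriv (b i) w (z i)) :
    ∑ i, ⟪z i, v i⟫_ℂ + ω * ⟪w, u⟫_ℂ = ⟪w, N⟫_ℂ + quarticForm (E₁L2 f) u w := by
  obtain ⟨F, hF, hlim⟩ := mem_closure_iff_seq_limit.1 (mem_closure_testGraph b hw)
  choose g hg hFg using hF
  obtain rfl : F = fun n => ((g n).toLp 2, fun i => (∂_{b i} (g n)).toLp 2) := funext hFg
  have hw' := (continuous_fst.tendsto _).comp hlim
  have hz' := (continuous_snd.tendsto _).comp hlim
  have hleft := ((tendsto_finsetSum Finset.univ fun i _ =>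
    ((tendsto_pi_nhds.1 hz' i).inner tendsto_const_nhds (𝕜 := ℂ) (y := v i))).add
    ((hw'.inner tendsto_const_nhds (𝕜 := ℂ) (y := u)).const_mul (ω : ℂ)))
  have hright := (hw'.inner tendsto_const_nhds (𝕜 := ℂ) (y := N)).add
    (tendsto_quarticForm_right (V := E₁L2 f) (b := b) (by simp) (memLp_four (by simp) b hv) hw
      (fun n i => hasWeakDeriv_toLp (b i) (g n)) hw' hz')
  exact tendsto_nhds_unique hleft (hright.congr fun n => (hu.weakForm_toLp hv hN hf (hg n)).symm)

end Equation

/-! ### Differentiation along translations -/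

theorem hasDerivAt_mul_of_eq_zero {a b : ℝ → ℝ} {a' : ℝ} (ha : HasDerivAt a a' 0) (ha₀ : a 0 = 0)
    (hb : ContinuousAt b 0) : HasDerivAt (fun s => a s * b s) (a' * b 0) 0 := by
  rw [hasDerivAt_iff_tendsto_slope_zero] at ha ⊢
  refine (ha.mul (hb.tendsto.mono_left nhdsWithin_le_nhds)).congr fun s => ?_
  simp [ha₀, mul_assoc]

section CentralDifference

variable {E : Type*} [NormedAddCommGroup E] [InnerProductSpace ℝ E] [FiniteDimensional ℝ E]
  [MeasurableSpace E] [BorelSpace E] {m : E} {u v : L²(E)}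

/-- The symmetric difference `f (· + h) - f (· - h)`. -/
def centralDiff (h : E) (f : L²(E)) : L²(E) := translate h f - translate (-h) f

theorem centralDiff_zero (f : L²(E)) : centralDiff 0 f = 0 := by
  rw [centralDiff, neg_zero, sub_self]

theorem fourier_centralDiff (h : E) (f : L²(E)) :
    𝓕 (centralDiff h f) = (2 * Complex.I) • sinMul h (𝓕 f) := by
  rw [centralDiff, fourier_sub, fourier_translate, fourier_translate, sinMul_apply,
    smul_inv_smul₀ (by simp)]

theorem fourier_sinMul (τ : E) (f : L²(E)) :
    𝓕 (sinMul τ f) = (2 * Complex.I)⁻¹ • (translate (-τ) (𝓕 f) - translate τ (𝓕 f)) := by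
  rw [sinMul_apply, FourierTransform.fourier_smul, fourier_sub, fourier_modulate,
    fourier_modulate, neg_neg]

theorem HasWeakDeriv.centralDiff (h : E) (hu : HasWeakDeriv m u v) :
    HasWeakDeriv m (centralDiff h u) (centralDiff h v) :=
  (hu.translate h).sub (hu.translate (-h))

theorem HasWeakDeriv.hasDerivAt_centralDiff (hu : HasWeakDeriv m u v) :
    HasDerivAt (fun s : ℝ => DaveyStewartson.centralDiff (s • m) u) (v + v) 0 := by
  have hneg : HasDerivAt (fun s : ℝ => DaveyStewartson.translate (-(s • m)) u) (-v) 0 := by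
    have h : HasDerivAt (fun s : ℝ => DaveyStewartson.translate (s • m) u) v (-0) := by
      simpa using hu.hasDerivAt_translate
    simpa [Function.comp_def] using h.scomp 0 (hasDerivAt_neg 0)
  simpa only [sub_neg_eq_add] using! hu.hasDerivAt_translate.sub hneg

theorem HasWeakDeriv.hasDerivAt_re_inner_clm_centralDiff (hu : HasWeakDeriv m u v)
    (A : L²(E) →L[ℂ] L²(E)) (w : L²(E)) :
    HasDerivAt (fun s : ℝ => (⟪A (DaveyStewartson.centralDiff (s • m) u), w⟫_ℂ).re)
      (2 * (⟪A v, w⟫_ℂ).re) 0 := by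
  have h := ((A.restrictScalars ℝ).hasFDerivAt.comp_hasDerivAt (0 : ℝ)
    hu.hasDerivAt_centralDiff).inner ℂ (hasDerivAt_const (0 : ℝ) w)
  simpa [two_mul, inner_add_left] using! Complex.reCLM.hasFDerivAt.comp_hasDerivAt (0 : ℝ) h

/-- Discretely integrating by parts moves both differences onto the factor `sin (2π τ·x)`. -/
theorem re_inner_sinMul_centralDiff (h τ : E) (v : L²(E)) :
    (⟪sinMul τ (centralDiff h v), v⟫_ℂ).re =
      (1 - cos (2 * π * ⟪τ, h⟫_ℝ)) * (⟪sinMul τ (translate h v), v⟫_ℂ).re -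
        sin (2 * π * ⟪τ, h⟫_ℝ) * (⟪cosMul τ (translate h v), v⟫_ℂ).re := by
  have hneg : (⟪sinMul τ (translate (-h) v), v⟫_ℂ).re =
      (⟪translate h (sinMul τ v), v⟫_ℂ).re := by
    rw [inner_sinMul_left, inner_translate_left, neg_neg, ← inner_conj_symm, Complex.conj_re]
  rw [centralDiff, map_sub, inner_sub_left, Complex.sub_re, hneg, translate_sinMul, inner_add_left,
    inner_smul_left, inner_smul_left, Complex.conj_ofReal, Complex.conj_ofReal, Complex.add_re,
    Complex.re_ofReal_mul, Complex.re_ofReal_mul]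
  ring

theorem hasDerivAt_re_inner_sinMul_centralDiff (m τ : E) (v : L²(E)) :
    HasDerivAt (fun s : ℝ => (⟪sinMul τ (centralDiff (s • m) v), v⟫_ℂ).re)
      (-(2 * π * ⟪τ, m⟫_ℝ) * (⟪cosMul τ v, v⟫_ℂ).re) 0 := by
  have htrans : ContinuousAt (fun s : ℝ => translate (s • m) v) 0 := by
    simpa [ContinuousAt, translate_zero, Function.comp_def] using
      (tendsto_translate v).comp (tendsto_smul_nhds_zero m)
  have hcont (A : L²(E) →L[ℂ] L²(E)) :
      ContinuousAt (fun s : ℝ => (⟪A (translate (s • m) v), v⟫_ℂ).re) 0 :=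
    Complex.continuous_re.continuousAt.comp
      ((A.continuous.continuousAt.comp htrans).inner continuousAt_const)
  have hlin : HasDerivAt (fun s : ℝ => 2 * π * ⟪τ, s • m⟫_ℝ) (2 * π * ⟪τ, m⟫_ℝ) 0 := by
    simpa [real_inner_smul_right, mul_left_comm] using
      (hasDerivAt_id (0 : ℝ)).mul_const (2 * π * ⟪τ, m⟫_ℝ)
  have hcos := hasDerivAt_mul_of_eq_zero (hlin.cos.const_sub 1) (by simp) (hcont (sinMul τ))
  have hsin := hasDerivAt_mul_of_eq_zero hlin.sin (by simp) (hcont (cosMul τ))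
  simp only [re_inner_sinMul_centralDiff]
  simpa [translate_zero] using! hcos.sub hsin

end CentralDifference

section PowerNonlinearity

theorem rpow_mul_le {p a b : ℝ} (hp : 1 ≤ p) (ha : 0 ≤ a) (hb : 0 ≤ b) :
    (p + 1) * (a ^ p * b) ≤ b ^ (p + 1) + p * a ^ (p + 1) := by
  have hp₀ : 0 < p := one_pos.trans_le hp
  have hconj : (p + 1).HolderConjugate ((p + 1) / p) := by
    simpa [Real.conjExponent] using Real.HolderConjugate.conjExponent (show 1 < p + 1 by linarith)
  have hyoung := Real.young_inequality_of_nonneg hb (rpow_nonneg ha p) hconj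
  rw [← rpow_mul ha, mul_div_cancel₀ _ hp₀.ne'] at hyoung
  have h := mul_le_mul_of_nonneg_left hyoung (by positivity : 0 ≤ p + 1)
  field_simp at h
  linarith

/-- The subgradient inequality for the convex function `z ↦ |z|^{p+1} / (p+1)`. -/
theorem re_mul_conj_sub_le {p : ℝ} (hp : 1 ≤ p) (z w : ℂ) :
    (((‖z‖ ^ (p - 1) : ℝ) : ℂ) * z * conj (w - z)).re ≤
      ‖w‖ ^ (p + 1) / (p + 1) - ‖z‖ ^ (p + 1) / (p + 1) := by
  have hz : ‖z‖ ^ (p - 1) * ‖z‖ = ‖z‖ ^ p := by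
    rw [← rpow_add_one' (norm_nonneg z) (by linarith), sub_add_cancel]
  have hcross : (((‖z‖ ^ (p - 1) : ℝ) : ℂ) * z * conj w).re ≤ ‖z‖ ^ p * ‖w‖ := by
    refine (Complex.re_le_norm _).trans_eq ?_
    rw [norm_mul, norm_mul, Complex.norm_conj, Complex.norm_real,
      Real.norm_of_nonneg (by positivity), hz]
  have hdiag : (((‖z‖ ^ (p - 1) : ℝ) : ℂ) * z * conj z).re = ‖z‖ ^ (p + 1) := by
    rw [mul_assoc, Complex.mul_conj, ← Complex.ofReal_mul, Complex.ofReal_re,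
      Complex.normSq_eq_norm_sq, sq, ← mul_assoc, hz, rpow_add_one' (norm_nonneg z) (by linarith)]
  have hyoung := rpow_mul_le hp (norm_nonneg z) (norm_nonneg w)
  rw [map_sub, mul_sub, Complex.sub_re, hdiag, ← sub_div, le_div_iff₀ (by linarith)]
  nlinarith

variable {E : Type*} [NormedAddCommGroup E] [InnerProductSpace ℝ E] [FiniteDimensional ℝ E]
  [MeasurableSpace E] [BorelSpace E] {F : E → ℝ} {p : ℝ} {u N v : L²(E)} {m : E}

/-- The density `|u|^{p+1} / (p+1)`. -/
def powerDensity (p : ℝ) (u : L²(E)) (x : E) : ℝ := ‖u x‖ ^ (p + 1) / (p + 1)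

theorem memLp_norm_rpow_mul (u : L²(E)) (hp : 1 ≤ p)
    (hu : MemLp (fun x => ‖u x‖ ^ p) 2 volume) :
    MemLp (fun x => ((‖u x‖ ^ (p - 1) : ℝ) : ℂ) * u x) 2 volume := by
  have hu' := Lp.aestronglyMeasurable u
  refine hu.of_le ?_ (Eventually.of_forall fun x => ?_)
  · exact (Complex.measurable_ofReal.comp_aemeasurable
      (hu'.norm.aemeasurable.pow_const (p - 1))).aestronglyMeasurable.mul hu'
  · rw [norm_mul, Complex.norm_real, Real.norm_of_nonneg (by positivity),
      Real.norm_of_nonneg (by positivity), ← rpow_add_one' (norm_nonneg _) (by linarith),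
      sub_add_cancel]

theorem integrable_powerDensity (hp : 1 ≤ p) (u : L²(E))
    (hu : MemLp (fun x => ‖u x‖ ^ p) 2 volume) : Integrable (powerDensity p u) volume := by
  refine ((hu.integrable_mul (Lp.memLp u).norm).div_const (p + 1)).congr
    (Eventually.of_forall fun x => ?_)
  simp only [Pi.mul_apply, powerDensity]
  rw [rpow_add_one' (norm_nonneg _) (by linarith)]

theorem integral_powerDensity_pos (hp : 1 ≤ p) {u : L²(E)}
    (hu : MemLp (fun x => ‖u x‖ ^ p) 2 volume) (hu₀ : u ≠ 0) : 0 < ∫ x, powerDensity p u x := by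
  have hnonneg : 0 ≤ powerDensity p u := fun x => by
    simp only [powerDensity]
    positivity
  refine (integral_nonneg hnonneg).lt_of_ne' fun h => hu₀ ((Lp.eq_zero_iff_ae_eq_zero).2 ?_)
  filter_upwards [(integral_eq_zero_iff_of_nonneg hnonneg (integrable_powerDensity hp u hu)).1 h]
    with x hx
  simpa [powerDensity, show p + 1 ≠ 0 by linarith, rpow_eq_zero_iff_of_nonneg] using hx

theorem integral_one_add_sin_mul_comp_add (hF : Integrable F volume) (τ h : E) :
    ∫ x, (1 + sin (2 * π * ⟪τ, x⟫_ℝ)) * F (x + h) =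
      (∫ x, F x) + cos (2 * π * ⟪τ, h⟫_ℝ) * (∫ x, sin (2 * π * ⟪τ, x⟫_ℝ) * F x) -
        sin (2 * π * ⟪τ, h⟫_ℝ) * (∫ x, cos (2 * π * ⟪τ, x⟫_ℝ) * F x) := by
  have hsin : Integrable (fun x => sin (2 * π * ⟪τ, x⟫_ℝ) * F x) volume :=
    hF.bdd_mul (c := 1) (by fun_prop) (Eventually.of_forall fun x => abs_sin_le_one _)
  have hcos : Integrable (fun x => cos (2 * π * ⟪τ, x⟫_ℝ) * F x) volume :=
    hF.bdd_mul (c := 1) (by fun_prop) (Eventually.of_forall fun x => abs_cos_le_one _)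
  have hshift := integral_add_right_eq_self
    (fun x => (1 + sin (2 * π * ⟪τ, x - h⟫_ℝ)) * F x) h (μ := volume)
  simp only [add_sub_cancel_right] at hshift
  rw [hshift, ← integral_const_mul, ← integral_const_mul,
    ← integral_add hF (hsin.const_mul _),
    ← integral_sub (by exact hF.add (hsin.const_mul _)) (hcos.const_mul _)]
  refine integral_congr_ae (Eventually.of_forall fun x => ?_)
  simp only [inner_sub_right, mul_sub, sin_sub]
  ring

theorem re_inner_add_sinMul (τ : E) (f g : L²(E)) :
    (⟪f + sinMul τ f, g⟫_ℂ).re = ∫ x, (1 + sin (2 * π * ⟪τ, x⟫_ℝ)) * (g x * conj (f x)).re := by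
  rw [L2.inner_def, ← RCLike.re_eq_complex_re, ← integral_re (L2.integrable_inner _ _)]
  refine integral_congr_ae ?_
  filter_upwards [Lp.coeFn_add f (sinMul τ f), coeFn_sinMul τ f] with x h₁ h₂
  rw [h₁, Pi.add_apply, h₂, RCLike.inner_apply, RCLike.re_eq_complex_re,
    ← Complex.re_ofReal_mul]
  congr 1
  simp only [map_add, map_mul, Complex.conj_ofReal]
  push_cast
  ring

theorem re_inner_add_sinMul_translate_sub_le (hp : 1 ≤ p)
    (hN : N =ᵐ[volume] fun x => ((‖u x‖ ^ (p - 1) : ℝ) : ℂ) * u x)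
    (hu : MemLp (fun x => ‖u x‖ ^ p) 2 volume) (τ h : E) :
    (⟪(translate h u - u) + sinMul τ (translate h u - u), N⟫_ℂ).re ≤
      (∫ x, (1 + sin (2 * π * ⟪τ, x⟫_ℝ)) * powerDensity p u (x + h)) -
        ∫ x, (1 + sin (2 * π * ⟪τ, x⟫_ℝ)) * powerDensity p u x := by
  have hF := integrable_powerDensity hp u hu
  have hbdd : ∀ x, ‖1 + sin (2 * π * ⟪τ, x⟫_ℝ)‖ ≤ 2 := fun x =>
    (norm_add_le _ _).trans (by
      rw [norm_one, norm_eq_abs]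
      linarith [abs_sin_le_one (2 * π * ⟪τ, x⟫_ℝ)])
  have hint {G : E → ℝ} (hG : Integrable G volume) :
      Integrable (fun x => (1 + sin (2 * π * ⟪τ, x⟫_ℝ)) * G x) volume :=
    hG.bdd_mul (by fun_prop) (Eventually.of_forall hbdd)
  rw [re_inner_add_sinMul, ← integral_sub (hint (hF.comp_add_right h)) (hint hF)]
  have hre : Integrable
      (fun x => (N x * conj ((translate h u - u : L²(E)) x)).re) volume :=
    (L2.integrable_inner (𝕜 := ℂ) (translate h u - u) N).re
  refine integral_mono_ae (hint hre)
    ((hint (hF.comp_add_right h)).sub (hint hF)) ?_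
  filter_upwards [hN, Lp.coeFn_sub (translate h u) u, coeFn_translate h u] with x h₁ h₂ h₃
  have hpos : 0 ≤ 1 + sin (2 * π * ⟪τ, x⟫_ℝ) := by linarith [neg_one_le_sin (2 * π * ⟪τ, x⟫_ℝ)]
  rw [h₁, h₂, Pi.sub_apply, h₃, ← mul_sub]
  exact mul_le_mul_of_nonneg_left (re_mul_conj_sub_le hp _ _) hpos

/-- Both sides of the subgradient inequality agree at `s = 0`, so their derivatives do as well. -/
theorem re_inner_add_sinMul_nonlinearity (hp : 1 ≤ p)
    (hN : N =ᵐ[volume] fun x => ((‖u x‖ ^ (p - 1) : ℝ) : ℂ) * u x)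
    (hu : MemLp (fun x => ‖u x‖ ^ p) 2 volume) (hv : HasWeakDeriv m u v) (τ : E) :
    (⟪v + sinMul τ v, N⟫_ℂ).re =
      -(2 * π * ⟪τ, m⟫_ℝ) * ∫ x, cos (2 * π * ⟪τ, x⟫_ℝ) * powerDensity p u x := by
  let A : L²(E) →L[ℂ] L²(E) := ContinuousLinearMap.id ℂ _ + sinMul τ
  have hlin : HasDerivAt (fun s : ℝ => 2 * π * ⟪τ, s • m⟫_ℝ) (2 * π * ⟪τ, m⟫_ℝ) 0 := by
    simpa [real_inner_smul_right, mul_left_comm] using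
      (hasDerivAt_id (0 : ℝ)).mul_const (2 * π * ⟪τ, m⟫_ℝ)
  have hleft : HasDerivAt (fun s : ℝ => (⟪A (translate (s • m) u - u), N⟫_ℂ).re)
      (⟪A v, N⟫_ℂ).re 0 := by
    have h := ((A.restrictScalars ℝ).hasFDerivAt.comp_hasDerivAt (0 : ℝ)
      (hv.hasDerivAt_translate.sub_const u)).inner ℂ (hasDerivAt_const (0 : ℝ) N)
    simpa using! Complex.reCLM.hasFDerivAt.comp_hasDerivAt (0 : ℝ) h
  have hright := ((hlin.cos.mul_const (∫ x, sin (2 * π * ⟪τ, x⟫_ℝ) * powerDensity p u x)).const_add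
    (∫ x, powerDensity p u x)).sub
      (hlin.sin.mul_const (∫ x, cos (2 * π * ⟪τ, x⟫_ℝ) * powerDensity p u x))
  have hF := integrable_powerDensity hp u hu
  have hmin : IsLocalMin (fun s : ℝ =>
      (∫ x, (1 + sin (2 * π * ⟪τ, x⟫_ℝ)) * powerDensity p u (x + s • m)) -
        (⟪A (translate (s • m) u - u), N⟫_ℂ).re) 0 := by
    refine Eventually.of_forall fun s => ?_
    have h := re_inner_add_sinMul_translate_sub_le hp hN hu τ (s • m)
    simp only [A, zero_smul, translate_zero, sub_self, map_zero, inner_zero_left, add_zero,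
      Complex.zero_re, sub_zero]
    exact le_sub_comm.1 h
  simp only [integral_one_add_sin_mul_comp_add hF] at hmin
  have h := hmin.hasDerivAt_eq_zero (hright.sub hleft)
  simp at h
  change (⟪A v, N⟫_ℂ).re = _
  linarith

theorem re_inner_sinMul_nonlinearity (hp : 1 ≤ p)
    (hN : N =ᵐ[volume] fun x => ((‖u x‖ ^ (p - 1) : ℝ) : ℂ) * u x)
    (hu : MemLp (fun x => ‖u x‖ ^ p) 2 volume) (hv : HasWeakDeriv m u v) (τ : E) :
    (⟪sinMul τ v, N⟫_ℂ).re =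
      -(2 * π * ⟪τ, m⟫_ℝ) * ∫ x, cos (2 * π * ⟪τ, x⟫_ℝ) * powerDensity p u x := by
  have h₀ := re_inner_add_sinMul_nonlinearity hp hN hu hv 0
  have hτ := re_inner_add_sinMul_nonlinearity hp hN hu hv τ
  simp only [sinMul_apply, neg_zero, sub_self, smul_zero, add_zero, inner_zero_left, mul_zero,
    zero_mul] at h₀
  rwa [inner_add_left, Complex.add_re, h₀, zero_add] at hτ

end PowerNonlinearity

/-! ### The nonlocal term -/

section Remainder

variable {E ι : Type*} [NormedAddCommGroup E] [InnerProductSpace ℝ E] [FiniteDimensional ℝ E]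
  [MeasurableSpace E] [BorelSpace E] [Fintype ι] {b : OrthonormalBasis ι ℝ E} {V u f : L²(E)}
  {v : ι → L²(E)}

theorem conj_sinMul_apply (hV : ∀ᵐ x, conj (V x) = V x) (τ : E) :
    ∀ᵐ x, conj (sinMul τ V x) = sinMul τ V x := by
  filter_upwards [hV, coeFn_sinMul τ V] with x h₁ h₂
  rw [h₂, map_mul, h₁, Complex.conj_ofReal]

theorem quarticForm_sinMul_right (V u w : L²(E)) (τ : E) :
    quarticForm V u (sinMul τ w) = quarticForm (sinMul τ V) u w := by
  refine integral_congr_ae ?_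
  filter_upwards [coeFn_sinMul τ V, coeFn_sinMul τ w] with x h₁ h₂
  rw [h₁, h₂, map_mul, Complex.conj_ofReal]
  ring

theorem quarticForm_translate_self (hf : f =ᵐ[volume] fun x => ((‖u x‖ ^ 2 : ℝ) : ℂ)) (V : L²(E))
    (h : E) : quarticForm V (translate h u) (translate h u) = ⟪translate h f, V⟫_ℂ := by
  rw [L2.inner_def]
  refine integral_congr_ae ?_
  filter_upwards [coeFn_translate h u, coeFn_translate h f,
    (measurePreserving_add_right volume h).quasiMeasurePreserving.ae hf] with x h₁ h₂ h₃
  rw [h₁, RCLike.inner_apply, h₂, h₃, Complex.mul_conj, Complex.normSq_eq_norm_sq,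
    Complex.conj_ofReal]

theorem memLp_four_translate (hu : MemLp u 4 volume) (h : E) :
    MemLp (translate h u) 4 volume :=
  (hu.comp_measurePreserving (measurePreserving_add_right volume h)).ae_eq
    (coeFn_translate h u).symm

theorem hasDerivAt_re_quarticForm_translate_sub (hE : Module.finrank ℝ E = 2)
    (hv : ∀ i, HasWeakDeriv (b i) u (v i)) (V : L²(E)) (j : ι) :
    HasDerivAt (fun s : ℝ => (quarticForm V (translate (s • b j) u - u)
      (translate (s • b j) u - u)).re) 0 0 := by
  obtain ⟨C, hC⟩ := exists_eLpNorm_four_sq_le hE b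
  let d (s : ℝ) (f : L²(E)) : L²(E) := translate (s • b j) f - f
  have hd (s : ℝ) := hC fun i => ((hv i).translate (s • b j)).sub (hv i)
  have hsmall : Tendsto (fun s : ℝ => ∑ i, ‖d s (v i)‖) (𝓝 0) (𝓝 0) := by
    have h (i : ι) : Tendsto (fun s : ℝ => ‖d s (v i)‖) (𝓝 0) (𝓝 0) := by
      simpa [d] using (((tendsto_translate (v i)).comp (tendsto_smul_nhds_zero (b j))).sub_const
        (v i)).norm
    simpa using tendsto_finsetSum _ fun i _ => h i
  have hlin : (fun s : ℝ => ‖d s u‖) =O[𝓝 0] fun s => s := by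
    simpa [d, translate_zero] using (hv j).hasDerivAt_translate.isBigO_sub.norm_left
  have hquad : (fun s : ℝ => ‖d s u‖ * ∑ i, ‖d s (v i)‖) =o[𝓝 0] fun s => s := by
    simpa using hlin.mul_isLittleO ((Asymptotics.isLittleO_one_iff ℝ).2 hsmall)
  have hbound (s : ℝ) :
      ‖(quarticForm V (d s u) (d s u)).re‖ ≤ ‖V‖ * C * ‖‖d s u‖ * ∑ i, ‖d s (v i)‖‖ := by
    refine ((Complex.abs_re_le_norm _).trans (norm_quarticForm_le (hd s).1 (hd s).1)).trans ?_
    rw [← sq, mul_assoc, norm_of_nonneg (by positivity : 0 ≤ ‖d s u‖ * ∑ i, ‖d s (v i)‖)]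
    exact mul_le_mul_of_nonneg_left (hd s).2 (norm_nonneg V)
  have hzero : (quarticForm V (d 0 u) (d 0 u)).re = 0 := by
    simpa [d, translate_zero] using hbound 0
  rw [hasDerivAt_iff_isLittleO_nhds_zero]
  have hlittle := (Asymptotics.IsBigO.of_bound _ (Eventually.of_forall hbound)).trans_isLittleO
    hquad
  simp only [zero_add, smul_zero, sub_zero]
  exact hlittle.congr_left fun s => (sub_eq_self.2 hzero).symm

theorem hasDerivAt_re_quarticForm_centralDiff (hE : Module.finrank ℝ E = 2)
    (hv : ∀ i, HasWeakDeriv (b i) u (v i)) (hf : f =ᵐ[volume] fun x => ((‖u x‖ ^ 2 : ℝ) : ℂ))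
    (hV : ∀ᵐ x, conj (V x) = V x) (j : ι) {c : ℝ}
    (hc : HasDerivAt (fun s : ℝ => (⟪centralDiff (s • b j) f, V⟫_ℂ).re) c 0) :
    HasDerivAt (fun s : ℝ => (quarticForm V u (centralDiff (s • b j) u)).re) (c / 2) 0 := by
  have hu := memLp_four hE b hv
  have hpos := hasDerivAt_re_quarticForm_translate_sub hE hv V j
  have hneg : HasDerivAt (fun s : ℝ => (quarticForm V (translate (-(s • b j)) u - u)
      (translate (-(s • b j)) u - u)).re) 0 0 := by
    rw [← neg_zero] at hpos
    simpa [Function.comp_def] using hpos.scomp 0 (hasDerivAt_neg 0)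
  have h := (hc.sub (hpos.sub hneg)).div_const 2
  simp only [sub_zero] at h
  refine h.congr_of_eventuallyEq (Eventually.of_forall fun s => ?_)
  have hpolar := two_mul_re_quarticForm_sub hV hu (memLp_four_translate hu (s • b j))
    (memLp_four_translate hu (-(s • b j)))
  rw [quarticForm_translate_self hf, quarticForm_translate_self hf, ← Complex.sub_re,
    ← inner_sub_left] at hpolar
  simp only [Pi.sub_apply]
  rw [eq_div_iff two_ne_zero, mul_comm]
  exact hpolar

end Remainder

section Kernel

variable {φ : Plane → ℝ} {K : ℝ}

theorem abs_symbol_sub_mul_norm_le (ξ η : Plane) : |symbol η - symbol ξ| * ‖ξ‖ ≤ ‖ξ - η‖ := by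
  rcases eq_or_ne ξ 0 with rfl | hξ
  · simp
  rcases eq_or_ne η 0 with rfl | hη
  · have hzero : symbol 0 = 0 := by simp [symbol]
    rw [hzero, zero_sub, abs_neg, abs_of_nonneg (symbol_nonneg ξ), sub_zero]
    exact mul_le_of_le_one_left (norm_nonneg _) (symbol_le_one ξ)
  have hnorm (ζ : Plane) : ‖ζ‖ ^ 2 = ζ 0 ^ 2 + ζ 1 ^ 2 := by
    rw [EuclideanSpace.real_norm_sq_eq, Fin.sum_univ_two]
  have hfactor : symbol η - symbol ξ =
      ((η 0 * ξ 1 - η 1 * ξ 0) * (η 0 * ξ 1 + η 1 * ξ 0)) / (‖η‖ ^ 2 * ‖ξ‖ ^ 2) := by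
    unfold symbol
    rw [div_sub_div _ _ (by positivity) (by positivity), hnorm ξ, hnorm η]
    congr 1
    ring
  have hcross : |η 0 * ξ 1 - η 1 * ξ 0| ≤ ‖η‖ * ‖ξ - η‖ := by
    refine abs_le_of_sq_le_sq ?_ (by positivity)
    rw [mul_pow, hnorm, hnorm, PiLp.sub_apply, PiLp.sub_apply]
    nlinarith [sq_nonneg (η 0 * (ξ 0 - η 0) + η 1 * (ξ 1 - η 1))]
  have hsum : |η 0 * ξ 1 + η 1 * ξ 0| ≤ ‖η‖ * ‖ξ‖ := by
    refine abs_le_of_sq_le_sq ?_ (by positivity)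
    rw [mul_pow, hnorm, hnorm]
    nlinarith [sq_nonneg (η 0 * ξ 0 - η 1 * ξ 1)]
  rw [hfactor, abs_div, abs_mul, abs_of_pos (by positivity : 0 < ‖η‖ ^ 2 * ‖ξ‖ ^ 2),
    div_mul_eq_mul_div, div_le_iff₀ (by positivity)]
  calc |η 0 * ξ 1 - η 1 * ξ 0| * |η 0 * ξ 1 + η 1 * ξ 0| * ‖ξ‖
      ≤ (‖η‖ * ‖ξ - η‖) * (‖η‖ * ‖ξ‖) * ‖ξ‖ := by gcongr
    _ = _ := by ring

/-- The kernel `σ(ξ - τ) φ(ξ) - σ(ξ) φ(ξ - τ)`, where `σ` is the symbol of `E₁`. -/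
def nonlocalKernel (φ : Plane → ℝ) (τ ξ : Plane) : ℝ :=
  symbol (ξ - τ) * φ ξ - symbol ξ * φ (ξ - τ)

theorem abs_nonlocalKernel_le (h₀ : φ 0 = 0) (hK : 0 ≤ K)
    (hφ : ∀ ξ η, |φ ξ - φ η| ≤ K * ‖ξ - η‖) (τ ξ : Plane) :
    |nonlocalKernel φ τ ξ| ≤ 2 * K * ‖τ‖ := by
  have hsymbol : |symbol (ξ - τ) - symbol ξ| * |φ ξ| ≤ K * ‖τ‖ := by
    have hξ : |φ ξ| ≤ K * ‖ξ‖ := by simpa [h₀] using hφ ξ 0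
    calc |symbol (ξ - τ) - symbol ξ| * |φ ξ|
        ≤ |symbol (ξ - τ) - symbol ξ| * (K * ‖ξ‖) := by gcongr
      _ = K * (|symbol (ξ - τ) - symbol ξ| * ‖ξ‖) := by ring
      _ ≤ K * ‖ξ - (ξ - τ)‖ := by gcongr; exact abs_symbol_sub_mul_norm_le _ _
      _ = K * ‖τ‖ := by rw [sub_sub_cancel]
  have hlip : symbol ξ * |φ ξ - φ (ξ - τ)| ≤ K * ‖τ‖ := by
    simpa using (mul_le_of_le_one_left (abs_nonneg _) (symbol_le_one ξ)).trans (hφ ξ (ξ - τ))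
  calc |nonlocalKernel φ τ ξ|
      = |(symbol (ξ - τ) - symbol ξ) * φ ξ + symbol ξ * (φ ξ - φ (ξ - τ))| := by
        rw [nonlocalKernel]; ring_nf
    _ ≤ |symbol (ξ - τ) - symbol ξ| * |φ ξ| + symbol ξ * |φ ξ - φ (ξ - τ)| := by
        refine (abs_add_le _ _).trans_eq ?_
        rw [abs_mul, abs_mul, abs_of_nonneg (symbol_nonneg ξ)]
    _ ≤ 2 * K * ‖τ‖ := by linarith

theorem measurable_nonlocalKernel (hφ : Measurable φ) (τ : Plane) :
    Measurable (nonlocalKernel φ τ) :=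
  ((measurable_symbol.comp (measurable_id.sub_const τ)).mul hφ).sub
    (measurable_symbol.mul (hφ.comp (measurable_id.sub_const τ)))

theorem re_inner_centralDiff_sinMul_E₁L2 (h τ : Plane) (f : L2) :
    (⟪centralDiff h f, sinMul τ (E₁L2 f)⟫_ℂ).re =
      -(∫ ξ, (nonlocalKernel (fun ζ => sin (2 * π * ⟪h, ζ⟫_ℝ)) τ ξ : ℂ) *
        ((𝓕 f : L2) ξ * conj (translate (-τ) (𝓕 f) ξ))).re := by
  set g : L2 := 𝓕 f
  set G : L2 := 𝓕 (E₁L2 f)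
  have hplancherel : (⟪centralDiff h f, sinMul τ (E₁L2 f)⟫_ℂ).re =
      -(⟪translate (-τ) G, sinMul h g⟫_ℂ - ⟪translate (-τ) (sinMul h g), G⟫_ℂ).re := by
    rw [← Lp.inner_fourier_eq, fourier_centralDiff, fourier_sinMul, inner_smul_left,
      inner_smul_right, ← mul_assoc, inner_sub_right,
      inner_translate_left (-τ) (sinMul h g) G, neg_neg]
    have hcoeff : conj (2 * Complex.I) * (2 * Complex.I)⁻¹ = -1 := by
      rw [map_mul, map_ofNat, Complex.conj_I, mul_neg, neg_mul, mul_inv_cancel₀ (by simp)]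
    rw [hcoeff, neg_one_mul, Complex.neg_re, Complex.sub_re, Complex.sub_re,
      ← inner_conj_symm (translate (-τ) G), Complex.conj_re]
  rw [hplancherel, L2.inner_def, L2.inner_def, ← integral_sub (L2.integrable_inner _ _)
    (L2.integrable_inner _ _)]
  congr 2
  refine integral_congr_ae ?_
  have hsub := (measurePreserving_add_right (volume : Measure Plane) (-τ)).quasiMeasurePreserving
  filter_upwards [coeFn_sinMul h g, coeFn_translate (-τ) G, fourier_E₁L2 f,
    coeFn_translate (-τ) (sinMul h g), coeFn_translate (-τ) g, hsub.ae (coeFn_sinMul h g),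
    hsub.ae (fourier_E₁L2 f)] with ξ h₁ h₂ h₃ h₄ h₅ h₆ h₇
  rw [RCLike.inner_apply, RCLike.inner_apply, h₁, h₂, h₃, h₄, h₅, h₆, h₇, nonlocalKernel]
  simp only [map_mul, Complex.conj_ofReal, ← sub_eq_add_neg]
  push_cast
  ring

theorem abs_inv_mul_sin_sub_le (s x y : ℝ) :
    |s⁻¹ * sin (s * x) - s⁻¹ * sin (s * y)| ≤ |x - y| := by
  rcases eq_or_ne s 0 with rfl | hs
  · simp
  calc |s⁻¹ * sin (s * x) - s⁻¹ * sin (s * y)|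
      = |s|⁻¹ * |sin (s * x) - sin (s * y)| := by rw [← mul_sub, abs_mul, abs_inv]
    _ ≤ |s|⁻¹ * |s * x - s * y| := by gcongr ?_ * ?_; exact abs_sin_sub_sin_le _ _
    _ = |x - y| := by rw [← mul_sub, abs_mul, inv_mul_cancel_left₀ (abs_ne_zero.2 hs)]

theorem tendsto_inv_mul_sin (x : ℝ) : Tendsto (fun s => s⁻¹ * sin (s * x)) (𝓝[≠] 0) (𝓝 x) := by
  have h : HasDerivAt (fun s : ℝ => sin (s * x)) x 0 := by
    simpa using ((hasDerivAt_id (0 : ℝ)).mul_const x).sin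
  simpa using h.tendsto_slope_zero

theorem nonlocalKernel_const_mul (c : ℝ) (φ : Plane → ℝ) (τ ξ : Plane) :
    nonlocalKernel (fun ζ => c * φ ζ) τ ξ = c * nonlocalKernel φ τ ξ := by
  simp only [nonlocalKernel]
  ring

theorem hasDerivAt_re_inner_centralDiff_E₁L2 (m τ : Plane) (f : L2) :
    HasDerivAt (fun s : ℝ => (⟪centralDiff (s • m) f, sinMul τ (E₁L2 f)⟫_ℂ).re)
      (-(∫ ξ, (nonlocalKernel (fun ζ => 2 * π * ⟪m, ζ⟫_ℝ) τ ξ : ℂ) *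
        ((𝓕 f : L2) ξ * conj (translate (-τ) (𝓕 f) ξ))).re) 0 := by
  let φ (s : ℝ) (ζ : Plane) : ℝ := s⁻¹ * sin (s * (2 * π * ⟪m, ζ⟫_ℝ))
  have hlip (s : ℝ) (ξ η : Plane) : |φ s ξ - φ s η| ≤ 2 * π * ‖m‖ * ‖ξ - η‖ := by
    refine (abs_inv_mul_sin_sub_le s _ _).trans ?_
    rw [← mul_sub, ← inner_sub_right, abs_mul, abs_of_pos two_pi_pos, mul_assoc _ ‖m‖]
    exact mul_le_mul_of_nonneg_left (abs_real_inner_le_norm m (ξ - η)) two_pi_pos.le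
  have hint := tendsto_integral_multiplier (𝓕 f : L2) (l := 𝓝[≠] (0 : ℝ))
    (m := fun s ξ => (nonlocalKernel (φ s) τ ξ : ℂ)) (C := 2 * (2 * π * ‖m‖) * ‖τ‖)
    (m₀ := fun ξ => (nonlocalKernel (fun ζ => 2 * π * ⟪m, ζ⟫_ℝ) τ ξ : ℂ))
    (fun s => (Complex.measurable_ofReal.comp
      (measurable_nonlocalKernel (by fun_prop) τ)).aestronglyMeasurable)
    (fun s ξ => by
      rw [Complex.norm_real]
      exact abs_nonlocalKernel_le (by simp [φ]) (by positivity) (hlip s) τ ξ)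
    (Eventually.of_forall fun ξ => (Complex.continuous_ofReal.tendsto _).comp
      (((tendsto_inv_mul_sin _).const_mul _).sub ((tendsto_inv_mul_sin _).const_mul _)))
    (tendsto_const_nhds (x := translate (-τ) (𝓕 f : L2)))
  rw [hasDerivAt_iff_tendsto_slope_zero]
  refine ((Complex.continuous_re.tendsto _).comp hint).neg.congr fun s => ?_
  simp only [zero_add, zero_smul, centralDiff_zero, inner_zero_left, Complex.zero_re, sub_zero,
    re_inner_centralDiff_sinMul_E₁L2, smul_eq_mul, mul_neg, Function.comp_apply]
  rw [← Complex.re_ofReal_mul, ← integral_const_mul]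
  congr 3
  funext ξ
  have harg (ζ : Plane) : 2 * π * ⟪s • m, ζ⟫_ℝ = s * (2 * π * ⟪m, ζ⟫_ℝ) := by
    rw [real_inner_smul_left]
    ring
  simp only [φ, harg, nonlocalKernel_const_mul s⁻¹, Complex.ofReal_mul, mul_assoc]

theorem conj_E₁L2_apply {u f : L2} (hf : f =ᵐ[volume] fun x => ((‖u x‖ ^ 2 : ℝ) : ℂ)) :
    ∀ᵐ x, conj (E₁L2 f x) = E₁L2 f x := by
  have hreal : conjugate f = f := by
    refine Lp.ext ?_
    filter_upwards [coeFn_conjugate f, hf] with x h₁ h₂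
    rw [h₁, h₂, Complex.conj_ofReal]
  have h := coeFn_conjugate (E₁L2 f)
  rw [conjugate_E₁L2, hreal] at h
  exact h.symm

theorem differentiableAt_symbol {ξ : Plane} (hξ : ξ ≠ 0) : DifferentiableAt ℝ symbol ξ := by
  have hcoord : DifferentiableAt ℝ (fun η : Plane => η 0) ξ :=
    (EuclideanSpace.proj (𝕜 := ℝ) (0 : Fin 2)).differentiableAt
  have hnorm : DifferentiableAt ℝ (fun η : Plane => ‖η‖ ^ 2) ξ := differentiableAt_id.norm_sq ℝ
  have hne : ‖ξ‖ ^ 2 ≠ 0 := pow_ne_zero 2 (norm_ne_zero_iff.2 hξ)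
  unfold symbol
  fun_prop (disch := assumption)

theorem symbol_smul {c : ℝ} (hc : c ≠ 0) (ξ : Plane) : symbol (c • ξ) = symbol ξ := by
  rw [symbol, symbol, norm_smul, PiLp.smul_apply, smul_eq_mul, mul_pow, mul_pow, norm_eq_abs,
    sq_abs, mul_div_mul_left _ _ (pow_ne_zero 2 hc)]

theorem fderiv_symbol_self {ξ : Plane} (hξ : ξ ≠ 0) : fderiv ℝ symbol ξ ξ = 0 := by
  have hline : HasDerivAt (fun c : ℝ => c • ξ) ξ 1 := by
    simpa using (hasDerivAt_id (1 : ℝ)).smul_const ξ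
  have hsymbol : HasDerivAt (fun c : ℝ => symbol (c • ξ)) (fderiv ℝ symbol ξ ξ) 1 := by
    have h : HasFDerivAt symbol (fderiv ℝ symbol ξ) ((1 : ℝ) • ξ) := by
      simpa using (differentiableAt_symbol hξ).hasFDerivAt
    exact h.comp_hasDerivAt 1 hline
  refine hsymbol.unique ((hasDerivAt_const 1 (symbol ξ)).congr_of_eventuallyEq ?_)
  filter_upwards [eventually_ne_nhds one_ne_zero] with c hc using symbol_smul hc ξ

/-- The symbol `|m|² σ(ξ) - (m·ξ) ∂ₘσ(ξ)`, where `σ` is the symbol of `E₁`: the weight of `|𝓕 f|²`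
in the Pohozaev identity for the direction `m`. -/
def virialSymbol (m ξ : Plane) : ℝ := ‖m‖ ^ 2 * symbol ξ - ⟪m, ξ⟫_ℝ * fderiv ℝ symbol ξ m

theorem measurable_virialSymbol (m : Plane) : Measurable (virialSymbol m) :=
  (measurable_symbol.const_mul _).sub
    ((by fun_prop : Measurable fun ξ : Plane => ⟪m, ξ⟫_ℝ).mul
      (measurable_fderiv_apply_const ℝ symbol m))

theorem sum_virialSymbol (b : OrthonormalBasis (Fin 2) ℝ Plane) {ξ : Plane} (hξ : ξ ≠ 0) :
    ∑ j, virialSymbol (b j) ξ = 2 * symbol ξ := by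
  have heuler : ∑ j, ⟪b j, ξ⟫_ℝ * fderiv ℝ symbol ξ (b j) = 0 := by
    rw [← fderiv_symbol_self hξ]
    conv_rhs => rw [← b.sum_repr' ξ, map_sum]
    simp only [map_smul, smul_eq_mul, b.sum_repr']
  simp only [virialSymbol, Finset.sum_sub_distrib, heuler, b.norm_eq_one, one_pow, one_mul,
    sub_zero, Finset.sum_const, Finset.card_univ, Fintype.card_fin, nsmul_eq_mul, Nat.cast_ofNat]

theorem tendsto_nonlocalKernel (m : Plane) {ξ : Plane} (hξ : ξ ≠ 0) :
    Tendsto (fun t : ℝ => t⁻¹ * nonlocalKernel (inner ℝ m) (t • m) ξ) (𝓝[≠] 0)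
      (𝓝 (virialSymbol m ξ)) := by
  have hline : HasDerivAt (fun t : ℝ => ξ - t • m) (-m) 0 := by
    simpa using ((hasDerivAt_id (0 : ℝ)).smul_const m).const_sub ξ
  have hsymbol : HasDerivAt (fun t : ℝ => symbol (ξ - t • m)) (fderiv ℝ symbol ξ (-m)) 0 := by
    have h : HasFDerivAt symbol (fderiv ℝ symbol ξ) (ξ - (0 : ℝ) • m) := by
      simpa using (differentiableAt_symbol hξ).hasFDerivAt
    exact h.comp_hasDerivAt 0 hline
  have hlim := (hsymbol.tendsto_slope_zero.mul_const ⟪m, ξ⟫_ℝ).const_add (‖m‖ ^ 2 * symbol ξ)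
  rw [map_neg, neg_mul, ← sub_eq_add_neg, mul_comm (fderiv ℝ symbol ξ m)] at hlim
  refine hlim.congr' ?_
  filter_upwards [self_mem_nhdsWithin] with t ht
  have ht : t ≠ 0 := ht
  simp only [nonlocalKernel, zero_add, zero_smul, sub_zero, smul_eq_mul, inner_sub_right,
    real_inner_smul_right, real_inner_self_eq_norm_sq]
  field_simp
  ring

theorem abs_inv_mul_nonlocalKernel_le (m : Plane) (t : ℝ) (ξ : Plane) :
    |t⁻¹ * nonlocalKernel (inner ℝ m) (t • m) ξ| ≤ 2 * ‖m‖ ^ 2 := by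
  have hker := abs_nonlocalKernel_le (φ := inner ℝ m) (inner_zero_right m) (norm_nonneg m)
    (fun ξ η => by rw [← inner_sub_right]; exact abs_real_inner_le_norm m (ξ - η)) (t • m) ξ
  rcases eq_or_ne t 0 with rfl | ht
  · rw [inv_zero, zero_mul, abs_zero]
    positivity
  calc |t⁻¹ * nonlocalKernel (inner ℝ m) (t • m) ξ|
      ≤ |t|⁻¹ * (2 * ‖m‖ * ‖t • m‖) := by rw [abs_mul, abs_inv]; gcongr
    _ = 2 * ‖m‖ ^ 2 := by
      rw [norm_smul, norm_eq_abs]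
      field_simp [abs_ne_zero.2 ht]

theorem integrable_virialSymbol_mul (m : Plane) (g : L2) :
    Integrable (fun ξ => virialSymbol m ξ * ‖g ξ‖ ^ 2) volume := by
  refine (Lp.memLp g).norm.integrable_sq.bdd_mul (c := 2 * ‖m‖ ^ 2)
    (measurable_virialSymbol m).aestronglyMeasurable ?_
  filter_upwards [Measure.ae_ne volume (0 : Plane)] with ξ hξ
  exact le_of_tendsto (tendsto_nonlocalKernel m hξ).abs
    (Eventually.of_forall fun t => abs_inv_mul_nonlocalKernel_le m t ξ)

theorem tendsto_integral_nonlocalKernel (m : Plane) (g : L2) :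
    Tendsto (fun t : ℝ => (∫ ξ, ((t⁻¹ * nonlocalKernel (inner ℝ m) (t • m) ξ : ℝ) : ℂ) *
        (g ξ * conj (translate (-(t • m)) g ξ))).re) (𝓝[≠] 0)
      (𝓝 (∫ ξ, virialSymbol m ξ * ‖g ξ‖ ^ 2)) := by
  have hshift : Tendsto (fun t : ℝ => translate (-(t • m)) g) (𝓝[≠] 0) (𝓝 g) := by
    refine (tendsto_translate g).comp (Tendsto.mono_left ?_ nhdsWithin_le_nhds)
    simpa using (tendsto_smul_nhds_zero m).neg
  have h := (Complex.continuous_re.tendsto _).comp <| tendsto_integral_multiplier g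
    (C := 2 * ‖m‖ ^ 2) (m₀ := fun ξ => (virialSymbol m ξ : ℂ))
    (fun t => (Complex.measurable_ofReal.comp ((measurable_nonlocalKernel (by fun_prop) (t • m)
      ).const_mul t⁻¹)).aestronglyMeasurable)
    (fun t ξ => (Complex.norm_real _).trans_le (abs_inv_mul_nonlocalKernel_le m t ξ))
    ((Measure.ae_ne volume (0 : Plane)).mono fun ξ hξ =>
      (Complex.continuous_ofReal.tendsto _).comp (tendsto_nonlocalKernel m hξ)) hshift
  simpa only [Function.comp_def, Complex.mul_conj', ← Complex.ofReal_pow, ← Complex.ofReal_mul,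
    integral_complex_ofReal, Complex.ofReal_re] using h

theorem tendsto_integral_cos_mul {F : Plane → ℝ} (hF : Integrable F volume) (m : Plane) :
    Tendsto (fun t : ℝ => ∫ x, cos (2 * π * ⟪t • m, x⟫_ℝ) * F x) (𝓝 0) (𝓝 (∫ x, F x)) := by
  refine tendsto_integral_filter_of_dominated_convergence (fun x => ‖F x‖)
    (Eventually.of_forall fun t => ?_) (Eventually.of_forall fun t => ae_of_all _ fun x => ?_)
    hF.norm (ae_of_all _ fun x => ?_)
  · exact (by fun_prop : Continuous fun x : Plane =>
      cos (2 * π * ⟪t • m, x⟫_ℝ)).aestronglyMeasurable.mul hF.1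
  · rw [norm_mul]
    exact mul_le_of_le_one_left (norm_nonneg _) (abs_cos_le_one _)
  · have h : Continuous fun t : ℝ => cos (2 * π * ⟪t • m, x⟫_ℝ) * F x := by fun_prop
    simpa using h.tendsto 0

theorem tendsto_re_inner_cosMul (m : Plane) (g w : L2) :
    Tendsto (fun t : ℝ => (⟪cosMul (t • m) g, w⟫_ℂ).re) (𝓝 0) (𝓝 (⟪g, w⟫_ℂ).re) :=
  (Complex.continuous_re.tendsto _).comp
    (((tendsto_cosMul g).comp (tendsto_smul_nhds_zero m)).inner tendsto_const_nhds)

end Kernel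

/-! ### The Pohozaev identity -/

section Pohozaev

variable {p ω : ℝ} {u N f : L2} {v : Fin 2 → L2} {b : OrthonormalBasis (Fin 2) ℝ Plane}

theorem IsSolution.re_weakForm (hu : IsSolution p ω u)
    (hv : ∀ i, HasWeakDeriv (b i) u (v i))
    (hN : N =ᵐ[volume] fun x => ((‖u x‖ ^ (p - 1) : ℝ) : ℂ) * u x)
    (hf : f =ᵐ[volume] fun x => ((‖u x‖ ^ 2 : ℝ) : ℂ)) (h τ : Plane) :
    ∑ i, ((⟪sinMul τ (centralDiff h (v i)), v i⟫_ℂ).re +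
        2 * π * ⟪τ, b i⟫_ℝ * (⟪cosMul τ (centralDiff h u), v i⟫_ℂ).re) +
      ω * (⟪sinMul τ (centralDiff h u), u⟫_ℂ).re =
    (⟪sinMul τ (centralDiff h u), N⟫_ℂ).re +
      (quarticForm (sinMul τ (E₁L2 f)) u (centralDiff h u)).re := by
  have hweak := congrArg Complex.re
    (hu.weakForm hv hN hf fun i => ((hv i).centralDiff h).sinMul τ)
  rw [quarticForm_sinMul_right] at hweak
  simpa [inner_add_left, inner_smul_left] using hweak

/-- The derivative at `s = 0` of the weak form tested with
`sin (2π τ·x) (u (x + s m) - u (x - s m))`, where `τ = t b_j` and `m = b_j`, divided by `-2πt`. -/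
theorem IsSolution.truncated_pohozaev (hu : IsSolution p ω u) (hp : 1 ≤ p)
    (hv : ∀ i, HasWeakDeriv (b i) u (v i))
    (hN : N =ᵐ[volume] fun x => ((‖u x‖ ^ (p - 1) : ℝ) : ℂ) * u x)
    (hf : f =ᵐ[volume] fun x => ((‖u x‖ ^ 2 : ℝ) : ℂ)) (j : Fin 2) {t : ℝ} (ht : t ≠ 0) :
    (∑ i, (⟪cosMul (t • b j) (v i), v i⟫_ℂ).re) - 2 * (⟪cosMul (t • b j) (v j), v j⟫_ℂ).re +
        ω * (⟪cosMul (t • b j) u, u⟫_ℂ).re =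
      2 * (∫ x, cos (2 * π * ⟪t • b j, x⟫_ℝ) * powerDensity p u x) +
        2⁻¹ * (∫ ξ, ((t⁻¹ * nonlocalKernel (inner ℝ (b j)) (t • b j) ξ : ℝ) : ℂ) *
          ((𝓕 f : L2) ξ * conj (translate (-(t • b j)) (𝓕 f) ξ))).re := by
  set τ := t • b j
  have hleft := (HasDerivAt.fun_sum (u := Finset.univ) fun i _ =>
    (hasDerivAt_re_inner_sinMul_centralDiff (b j) τ (v i)).add
      (((hv j).hasDerivAt_re_inner_clm_centralDiff (cosMul τ) (v i)).const_mul
        (2 * π * ⟪τ, b i⟫_ℝ))).add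
    ((hasDerivAt_re_inner_sinMul_centralDiff (b j) τ u).const_mul ω)
  have hpower := (hv j).hasDerivAt_re_inner_clm_centralDiff (sinMul τ) N
  rw [re_inner_sinMul_nonlinearity hp hN (memLp_norm_rpow (by simp) b hv hp) (hv j)] at hpower
  have hnonlocal := hasDerivAt_re_quarticForm_centralDiff (by simp) hv hf
    (conj_sinMul_apply (conj_E₁L2_apply hf) τ) j (hasDerivAt_re_inner_centralDiff_E₁L2 (b j) τ f)
  have h := hleft.unique ((hpower.add hnonlocal).congr_of_eventuallyEq
    (Eventually.of_forall fun s => hu.re_weakForm hv hN hf (s • b j) τ))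
  have horth (i : Fin 2) : ⟪τ, b i⟫_ℝ = if i = j then t else 0 := by
    rw [real_inner_smul_left, b.inner_eq_ite, mul_ite, mul_one, mul_zero]
    simp only [eq_comm]
  let K : ℝ := (∫ ξ, (nonlocalKernel (inner ℝ (b j)) τ ξ : ℂ) *
    ((𝓕 f : L2) ξ * conj (translate (-τ) (𝓕 f) ξ))).re
  have hK (c : ℝ) : (∫ ξ, ((c * nonlocalKernel (inner ℝ (b j)) τ ξ : ℝ) : ℂ) *
      ((𝓕 f : L2) ξ * conj (translate (-τ) (𝓕 f) ξ))).re = c * K := by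
    simp only [K, Complex.ofReal_mul c, mul_assoc (Complex.ofReal c), integral_const_mul,
      Complex.re_ofReal_mul]
  simp only [nonlocalKernel_const_mul (2 * π), hK, horth, if_true, mul_ite, ite_mul, mul_zero,
    zero_mul, Finset.sum_add_distrib, Finset.sum_ite_eq', Finset.mem_univ, ← Finset.mul_sum] at h
  rw [hK]
  field_simp
  refine mul_left_cancel₀ pi_ne_zero ?_
  linear_combination -h

theorem IsSolution.directional_pohozaev (hu : IsSolution p ω u) (hp : 1 ≤ p)
    (hv : ∀ i, HasWeakDeriv (b i) u (v i))
    (hN : N =ᵐ[volume] fun x => ((‖u x‖ ^ (p - 1) : ℝ) : ℂ) * u x)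
    (hf : f =ᵐ[volume] fun x => ((‖u x‖ ^ 2 : ℝ) : ℂ)) (j : Fin 2) :
    (∑ i, ‖v i‖ ^ 2) - 2 * ‖v j‖ ^ 2 + ω * ‖u‖ ^ 2 =
      2 * (∫ x, powerDensity p u x) +
        2⁻¹ * ∫ ξ, virialSymbol (b j) ξ * ‖(𝓕 f : L2) ξ‖ ^ 2 := by
  have hF := integrable_powerDensity hp u (memLp_norm_rpow (by simp) b hv hp)
  have hcos (g : L2) := (tendsto_re_inner_cosMul (b j) g g).mono_left
    (nhdsWithin_le_nhds (s := {0}ᶜ))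
  simp only [inner_self_eq_norm_sq_to_K, Complex.coe_algebraMap, ← Complex.ofReal_pow,
    Complex.ofReal_re] at hcos
  refine tendsto_nhds_unique
    (((tendsto_finsetSum Finset.univ fun i _ => hcos (v i)).sub ((hcos (v j)).const_mul 2)).add
      ((hcos u).const_mul ω))
    (((((tendsto_integral_cos_mul hF (b j)).mono_left nhdsWithin_le_nhds).const_mul 2).add
      ((tendsto_integral_nonlocalKernel (b j) (𝓕 f)).const_mul 2⁻¹)).congr' ?_)
  filter_upwards [self_mem_nhdsWithin] with t ht
  exact (hu.truncated_pohozaev hp hv hN hf j ht).symm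

theorem IsSolution.pohozaev (hu : IsSolution p ω u) (hp : 1 ≤ p)
    (hv : ∀ i, HasWeakDeriv (b i) u (v i))
    (hN : N =ᵐ[volume] fun x => ((‖u x‖ ^ (p - 1) : ℝ) : ℂ) * u x)
    (hf : f =ᵐ[volume] fun x => ((‖u x‖ ^ 2 : ℝ) : ℂ)) :
    ω * ‖u‖ ^ 2 = 2 * (∫ x, powerDensity p u x) +
      2⁻¹ * ∫ ξ, symbol ξ * ‖(𝓕 f : L2) ξ‖ ^ 2 := by
  have hvirial : ∑ j, ∫ ξ, virialSymbol (b j) ξ * ‖(𝓕 f : L2) ξ‖ ^ 2 =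
      2 * ∫ ξ, symbol ξ * ‖(𝓕 f : L2) ξ‖ ^ 2 := by
    rw [← integral_finsetSum _ fun j _ => integrable_virialSymbol_mul (b j) (𝓕 f : L2),
      ← integral_const_mul]
    refine integral_congr_ae ?_
    filter_upwards [Measure.ae_ne volume (0 : Plane)] with ξ hξ
    rw [← Finset.sum_mul, sum_virialSymbol b hξ, mul_assoc]
  have h (j : Fin 2) := hu.directional_pohozaev hp hv hN hf j
  simp only [Fin.sum_univ_two] at h hvirial
  linarith [h 0, h 1]

end Pohozaev

end DaveyStewartson

end

theorem theorem2p3_general (p ω : ℝ) (hp : 1 ≤ p)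
    (h : ∃ u : DaveyStewartson.L2, u ≠ 0 ∧ DaveyStewartson.IsSolution p ω u) :
    0 < ω := by
  obtain ⟨u, hu₀, hu⟩ := h
  let b := EuclideanSpace.basisFun (Fin 2) ℝ
  choose v hv using fun i => DaveyStewartson.exists_hasWeakDeriv hu.memH1 (b i)
  have hpow := DaveyStewartson.memLp_norm_rpow (by simp) b hv hp
  have hN := DaveyStewartson.memLp_norm_rpow_mul u hp hpow
  have hf := DaveyStewartson.memLp_ofReal_norm_sq (by simp) b hv
  have hpohozaev := hu.pohozaev hp hv hN.coeFn_toLp hf.coeFn_toLp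
  have hpower := DaveyStewartson.integral_powerDensity_pos hp hpow hu₀
  have hnonlocal : 0 ≤ ∫ ξ, DaveyStewartson.symbol ξ *
      ‖(𝓕 (hf.toLp _) : DaveyStewartson.L2) ξ‖ ^ 2 :=
    integral_nonneg fun ξ => mul_nonneg (DaveyStewartson.symbol_nonneg ξ) (sq_nonneg _)
  refine pos_of_mul_pos_left (b := ‖u‖ ^ 2) ?_ (sq_nonneg _)
  linarith

theorem theorem2p3 (p ω : ℝ) (hp₁ : 1 < p) (hp₃ : p < 3)
    (h : ∃ u : DaveyStewartson.L2, u ≠ 0 ∧ DaveyStewartson.IsSolution p ω u) :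
    0 < ω :=
  theorem2p3_general p ω hp₁.le h
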